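/- Let $\sigma$ be a finite relational vocabulary and $k\ge 0$. For finite $\sigma$-structures $A,B$ let $S_k(A)$ be the poset of subsets of $A$ of size at most $k$. Let $I_k$ be the presheaf on $S_k(A)$ for which $I_k(C)$ is the set of partial isomorphisms from $A$ to $B$ with domain $C$, with restriction of functions as restriction maps. For a family $S$ of sets $S(C)$ of functions $C\to B$, $C\in S_k(A)$, let $S^{\Diamond}$ be the largest flasque presheaf contained in $S$ (a presheaf is flasque if all restriction maps are surjective). Let $S^{\#}(C)$ be the set of those $s\in S(C)$ such that, if $|C|<k$, there are $s_a\in S(C\cup\{a\})$ for $a\in A$ with $s_a|_C=s$ for which $a\mapsto s_a(a)$ is a bijection from $A$ to $B$. Put $S_0=I_k^{\Diamond}$, $S_{i+1}=(S_i^{\#})^{\Diamond}$, and $S_\infty=\bigcap_i S_i$. Then: 1. For all finite $A,B$ the sequence is decreasing, $S_i=S_\infty$ for all $i\ge N$ for some $N\le(|A||B|+1)^k$, and $(S_\infty^{\#})^{\Diamond}=S_\infty$. 2. For all finite $A,B$, $S_\infty\neq\varnothing$ (some $S_\infty(C)$ is non-empty) if and only if $A$ and $B$ satisfy the same sentences of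 the $k$-variable first-order logic with counting quantifiers $\exists^{\ge m}$ ($A\equiv_{C^k}B$). 3. If $k\ge1$ and $A\ne\varnothing$, this holds if and only if $A$ and $B$ are not distinguished by the $(k-1)$-dimensional Weisfeiler–Leman algorithm. Here the $d$-dimensional algorithm colours $d$-tuples, initially by their atomic types; in each round the colour of $x$ is refined by the multiset, over all elements $a$, of the atomic type of $(x,a)$ together with the colours of the $d$ tuples obtained from $x$ by replacing one component by $a$; $A$ and $B$ are distinguished if in some round some colour does not occur equally often in both. 4. For fixed $\sigma$ and $k$ there is a random access program (unit cost, arithmetic by addition and truncated subtraction) which, given the sizes and relation tables of two structures $A,B$ with universes $\{0,\dots,m-1\}$ and $\{0,\dots,n-1\}$, computes in time polynomial in $m+n$ the presheaf $S_\infty$ and whether it is non-empty; thus it decides in polynomial time whether $A\equiv_{C^k}B$ and, for $k\ge1$ and $m\ge1$, whether $A$ and $B$ are equivalent at level $k-1$ of the Weisfeiler–Leman algorithm. -/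

import Mathlib

universe u v w w'

namespace CountingPresheaf

/-! ### Presheaves of partial isomorphisms -/

/-- The poset of subsets of `A` of cardinality at most `k`. -/
abbrev Sk (A : Type w) (k : ℕ) : Type w := {C : Finset A // C.card ≤ k}

/-- A family of sets of local sections `S(C) ⊆ (C → B)`, indexed by the subsets `C` of `A` of
cardinality at most `k`, ordered by pointwise inclusion.  It need not be closed under
restriction. -/
abbrev Family (A : Type w) (B : Type w') (k : ℕ) : Type (max w w') :=
  (C : Sk A k) → Set (C.1 → B)

section

variable {A : Type w} {B : Type w'} {k : ℕ}

/-- Closure under restriction: the family is a presheaf, whose restriction maps are the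
restrictions of functions. -/
def IsPresheaf (S : Family A B k) : Prop :=
  ∀ (C' C : Sk A k) (h : C'.1 ⊆ C.1), ∀ s ∈ S C, Finset.restrict₂ (π := fun _ => B) h s ∈ S C'

/-- All restriction maps are surjective: every section over `C` extends to every larger `C'`. -/
def IsFlasque (S : Family A B k) : Prop :=
  ∀ (C C' : Sk A k) (h : C.1 ⊆ C'.1), ∀ s ∈ S C,
    ∃ t ∈ S C', Finset.restrict₂ (π := fun _ => B) h t = s

/-- Coflasquification: the union of all flasque presheaves contained in the family `S`, i.e. the
largest flasque presheaf contained in `S`. -/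
def coflasq (S : Family A B k) : Family A B k :=
  fun C => {s | ∃ T : Family A B k, IsPresheaf T ∧ IsFlasque T ∧ T ≤ S ∧ s ∈ T C}

/-- The set `C ∪ {a}`, for `|C| < k`. -/
def Sk.insert [DecidableEq A] (C : Sk A k) (hC : C.1.card < k) (a : A) : Sk A k :=
  ⟨Insert.insert a C.1, (Finset.card_insert_le a C.1).trans hC⟩

/-- The bijection-game condition on a section `s` over `C`: if `|C| < k`, there are sections
`t a ∈ S(C ∪ {a})` extending `s`, one for each `a : A`, such that `a ↦ (t a) a` is a bijection from
`A` to `B`. There is no condition if `|C| = k`. -/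
def Cotest [DecidableEq A] (S : Family A B k) (C : Sk A k) (s : C.1 → B) : Prop :=
  ∀ hC : C.1.card < k,
    ∃ t : (a : A) → ((Sk.insert C hC a).1 → B),
      (∀ a, t a ∈ S (Sk.insert C hC a)) ∧
      (∀ a, Finset.restrict₂ (π := fun _ => B) (Finset.subset_insert a C.1) (t a) = s) ∧
      Function.Bijective (fun a => t a ⟨a, Finset.mem_insert_self a C.1⟩)

/-- The family of those sections of `S` that pass the bijection-game condition in `S`. -/
def cotestFilter [DecidableEq A] (S : Family A B k) : Family A B k :=
  fun C => {s | s ∈ S C ∧ Cotest S C s}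

end

/-- `s : C → B` is a partial isomorphism from `A` to `B` with domain `C`. -/
def IsPartialIso (L : FirstOrder.Language.{u, v}) {A : Type w} {B : Type w'} [L.Structure A] [L.Structure B]
    (C : Finset A) (s : C → B) : Prop :=
  Function.Injective s ∧
    ∀ (n : ℕ) (R : L.Relations n) (x : Fin n → C),
      FirstOrder.Language.Structure.RelMap R (fun i => (x i : A)) ↔
        FirstOrder.Language.Structure.RelMap R (fun i => s (x i))

/-- The presheaf of partial isomorphisms. -/
def partialIsos (L : FirstOrder.Language.{u, v}) (A : Type w) (B : Type w') [L.Structure A] [L.Structure B]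
    (k : ℕ) : Family A B k :=
  fun C => {s | IsPartialIso L C.1 s}

/-- The iterative process: coflasquify the presheaf of partial isomorphisms, then alternately
filter by the bijection-game condition and coflasquify. -/
def cofpIter (L : FirstOrder.Language.{u, v}) (A : Type w) (B : Type w') [DecidableEq A]
    [L.Structure A] [L.Structure B] (k : ℕ) : ℕ → Family A B k
  | 0 => coflasq (partialIsos L A B k)
  | m + 1 => coflasq (cotestFilter (cofpIter L A B k m))

/-- The limit (intersection) of the decreasing process `cofpIter`. -/
def cofp (L : FirstOrder.Language.{u, v}) (A : Type w) (B : Type w') [DecidableEq A]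
    [L.Structure A] [L.Structure B] (k : ℕ) : Family A B k :=
  fun C => ⋂ m : ℕ, cofpIter L A B k m C

/-! ### The `k`-variable logic with counting quantifiers -/

/-- Formulas of `k`-variable counting logic over a relational language: the variables are the
elements of `Fin k`, and `existsGE m x φ` is `∃^{≥ m} x. φ`. -/
inductive CFormula (L : FirstOrder.Language.{u, v}) (k : ℕ) : Type v
  | falsum : CFormula L k
  | equal (x y : Fin k) : CFormula L k
  | rel {n : ℕ} (R : L.Relations n) (x : Fin n → Fin k) : CFormula L k
  | neg (φ : CFormula L k) : CFormula L k
  | conj (φ ψ : CFormula L k) : CFormula L k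
  | existsGE (m : ℕ) (x : Fin k) (φ : CFormula L k) : CFormula L k

namespace CFormula

variable {L : FirstOrder.Language.{u, v}} {k : ℕ}

/-- The free variables of a formula. -/
def freeVars : CFormula L k → Finset (Fin k)
  | falsum => ∅
  | equal x y => {x, y}
  | rel _ x => Finset.univ.image x
  | neg φ => φ.freeVars
  | conj φ ψ => φ.freeVars ∪ ψ.freeVars
  | existsGE _ x φ => φ.freeVars.erase x

/-- Satisfaction under a partial assignment of the variables.  Partial assignments are used so that
sentences have their usual meaning also in a structure with empty universe. -/
def Realize {A : Type w} [L.Structure A] : CFormula L k → (Fin k → Option A) → Prop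
  | falsum, _ => False
  | equal x y, ρ => ∃ a : A, ρ x = some a ∧ ρ y = some a
  | rel (n := n) R x, ρ =>
      ∃ a : Fin n → A, (∀ i, ρ (x i) = some (a i)) ∧ FirstOrder.Language.Structure.RelMap R a
  | neg φ, ρ => ¬ φ.Realize ρ
  | conj φ ψ, ρ => φ.Realize ρ ∧ ψ.Realize ρ
  | existsGE m x φ, ρ => m ≤ Nat.card {a : A // φ.Realize (Function.update ρ x (some a))}

end CFormula

/-- `A` and `B` satisfy the same sentences of `k`-variable counting logic. -/
def CountingEquiv (L : FirstOrder.Language.{u, v}) (A : Type w) (B : Type w') [L.Structure A] [L.Structure B]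
    (k : ℕ) : Prop :=
  ∀ φ : CFormula L k, φ.freeVars = ∅ →
    (φ.Realize (fun _ => (none : Option A)) ↔ φ.Realize (fun _ => (none : Option B)))

/-! ### The Weisfeiler-Leman algorithm -/

/-- Atomic types of `d`-tuples: which components are equal, and which relations hold between
components. -/
structure AtomicType (L : FirstOrder.Language.{u, v}) (d : ℕ) : Type v where
  eq : Fin d → Fin d → Prop
  rel : (n : ℕ) → L.Relations n → (Fin n → Fin d) → Prop

/-- The atomic type of a tuple. -/
def atp (L : FirstOrder.Language.{u, v}) {A : Type w} [L.Structure A] {d : ℕ} (x : Fin d → A) :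
    AtomicType L d where
  eq i j := x i = x j
  rel _ R f := FirstOrder.Language.Structure.RelMap R (fun i => x (f i))

/-- The colours used in round `i` of the `d`-dimensional Weisfeiler-Leman algorithm. -/
def WLColor (L : FirstOrder.Language.{u, v}) (d : ℕ) : ℕ → Type v
  | 0 => AtomicType L d
  | i + 1 => WLColor L d i × Multiset (AtomicType L (d + 1) × (Fin d → WLColor L d i))

/-- The colour of a `d`-tuple in round `i`: initially its atomic type; in each round, the colour
of `x` is refined by the multiset, over `a : A`, of the atomic type of `(x, a)` together with the
colours of the `d` tuples obtained by replacing a component of `x` by `a`. -/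
def wlColor (L : FirstOrder.Language.{u, v}) {A : Type w} [L.Structure A] [Fintype A] {d : ℕ} :
    (i : ℕ) → (Fin d → A) → WLColor L d i
  | 0, x => atp L x
  | i + 1, x =>
      (wlColor L i x,
        (Finset.univ : Finset A).val.map fun a =>
          (atp L (Fin.snoc (α := fun _ => A) x a), fun j => wlColor L i (Function.update x j a)))

/-- `A` and `B` are not distinguished by the `d`-dimensional Weisfeiler-Leman algorithm: in each
round, each colour occurs equally often in `A` and in `B`. -/
def WLEquiv (L : FirstOrder.Language.{u, v}) (A : Type w) (B : Type w') [L.Structure A] [L.Structure B]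
    [Fintype A] [Fintype B] (d : ℕ) : Prop :=
  ∀ i : ℕ,
    (Finset.univ : Finset (Fin d → A)).val.map (wlColor L i) =
      (Finset.univ : Finset (Fin d → B)).val.map (wlColor L i)

/-! ### Random access programs with a step count

Unit-cost random access programs on natural numbers whose arithmetic is addition and truncated
subtraction, so that polynomial time is the usual notion. -/

/-- A state assigns a number to each variable, and an infinite array of numbers to each array
name. -/
structure RamState where
  var : ℕ → ℕ
  arr : ℕ → ℕ → ℕ

/-- Expressions: constants, variables, array access, addition, truncated subtraction. -/
inductive RamExpr : Type
  | lit (c : ℕ) : RamExpr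
  | var (x : ℕ) : RamExpr
  | get (a : ℕ) (i : RamExpr) : RamExpr
  | add (e f : RamExpr) : RamExpr
  | sub (e f : RamExpr) : RamExpr

namespace RamExpr

/-- The value of an expression. -/
def eval : RamExpr → RamState → ℕ
  | lit c, _ => c
  | var x, σ => σ.var x
  | get a i, σ => σ.arr a (i.eval σ)
  | add e f, σ => e.eval σ + f.eval σ
  | sub e f, σ => e.eval σ - f.eval σ

/-- The number of steps needed to evaluate an expression: one for each node. -/
def cost : RamExpr → ℕ
  | lit _ => 1
  | var _ => 1
  | get _ i => i.cost + 1
  | add e f => e.cost + f.cost + 1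
  | sub e f => e.cost + f.cost + 1

end RamExpr

/-- Programs. -/
inductive RamProg : Type
  | skip : RamProg
  | assign (x : ℕ) (e : RamExpr) : RamProg
  | store (a : ℕ) (i e : RamExpr) : RamProg
  | seq (p q : RamProg) : RamProg
  | ite (e : RamExpr) (p q : RamProg) : RamProg
  | loop (e : RamExpr) (p : RamProg) : RamProg

/-- `Exec p σ t τ`: started in state `σ`, the program `p` halts after `t` steps in state `τ`.
The program `ite e p q` runs `p` if the value of `e` is nonzero, and `q` otherwise;
`loop e p` runs `p` as long as the value of `e` is nonzero. -/
inductive Exec : RamProg → RamState → ℕ → RamState → Prop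
  | skip (σ : RamState) : Exec .skip σ 1 σ
  | assign (x : ℕ) (e : RamExpr) (σ : RamState) :
      Exec (.assign x e) σ (e.cost + 1) { σ with var := Function.update σ.var x (e.eval σ) }
  | store (a : ℕ) (i e : RamExpr) (σ : RamState) :
      Exec (.store a i e) σ (i.cost + e.cost + 1)
        { σ with arr :=
            Function.update σ.arr a (Function.update (σ.arr a) (i.eval σ) (e.eval σ)) }
  | seq {p q : RamProg} {σ τ υ : RamState} {t t' : ℕ} :
      Exec p σ t τ → Exec q τ t' υ → Exec (.seq p q) σ (t + t' + 1) υ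
  | ite_true {e : RamExpr} {p q : RamProg} {σ τ : RamState} {t : ℕ} :
      e.eval σ ≠ 0 → Exec p σ t τ → Exec (.ite e p q) σ (e.cost + t + 1) τ
  | ite_false {e : RamExpr} {p q : RamProg} {σ τ : RamState} {t : ℕ} :
      e.eval σ = 0 → Exec q σ t τ → Exec (.ite e p q) σ (e.cost + t + 1) τ
  | loop_true {e : RamExpr} {p : RamProg} {σ τ υ : RamState} {t t' : ℕ} :
      e.eval σ ≠ 0 → Exec p σ t τ → Exec (.loop e p) τ t' υ →
        Exec (.loop e p) σ (e.cost + t + t' + 1) υ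
  | loop_false {e : RamExpr} {p : RamProg} {σ : RamState} :
      e.eval σ = 0 → Exec (.loop e p) σ (e.cost + 1) σ

/-- The 0/1 table of an `n`-ary relation on `Fin m`; the entry of the tuple `x` stands at
position `∑ i, x i * m ^ i`. -/
noncomputable def relTable {m n : ℕ} (P : (Fin n → Fin m) → Prop) (c : ℕ) : ℕ :=
  open Classical in
  if ∃ x : Fin n → Fin m, c = ∑ i : Fin n, (x i : ℕ) * m ^ (i : ℕ) ∧ P x then 1 else 0

/-- The input state for two structures with universes `Fin m` and `Fin n`, over a language whose
`r` relation symbols are enumerated by `e`: variables 0 and 1 hold `m` and `n`, arrays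
`0, …, r - 1` hold the tables of the relations of the first structure, and arrays `r, …, 2 r - 1`
those of the second one; everything else is 0. -/
noncomputable def inputState {L : FirstOrder.Language.{u, v}} {r : ℕ} (e : Fin r ≃ Σ n, L.Relations n)
    (m n : ℕ) [L.Structure (Fin m)] [L.Structure (Fin n)] : RamState where
  var x := if x = 0 then m else if x = 1 then n else 0
  arr a :=
    if h : a < r then
      relTable (m := m) fun x => FirstOrder.Language.Structure.RelMap (e ⟨a, h⟩).2 x
    else if h : a - r < r then
      relTable (m := n) fun x => FirstOrder.Language.Structure.RelMap (e ⟨a - r, h⟩).2 x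
    else fun _ => 0

/-- `S` has a section whose graph is the set of pairs `(x i, y i)`. -/
def HasGraph {A : Type w} {B : Type w'} {k l : ℕ} (S : Family A B k)
    (x : Fin l → A) (y : Fin l → B) : Prop :=
  ∃ C : Sk A k, ∃ s ∈ S C,
    ∀ (a : A) (b : B), (∃ h : a ∈ C.1, s ⟨a, h⟩ = b) ↔ ∃ i, x i = a ∧ y i = b

/-- The state `τ` represents the family `S`: variable 0 tells whether `S` has any section, and
array 0 tells, at position `∑ i, x i * m ^ i + m ^ k * ∑ i, y i * n ^ i`, whether
`{(x i, y i) | i < k}` is the graph of a section of `S`. (As repetitions are allowed, every section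
with nonempty domain has such a listing; if `S` is a presheaf, then the section with empty domain
is in `S` as soon as `S` has any section.) -/
def Represents {k m n : ℕ} (τ : RamState) (S : Family (Fin m) (Fin n) k) : Prop :=
  (S ≠ ⊥ → τ.var 0 = 1) ∧ (S = ⊥ → τ.var 0 = 0) ∧
    ∀ (x : Fin k → Fin m) (y : Fin k → Fin n),
      (HasGraph S x y → τ.arr 0 (∑ i : Fin k, (x i : ℕ) * m ^ (i : ℕ)
        + m ^ k * ∑ i : Fin k, (y i : ℕ) * n ^ (i : ℕ)) = 1) ∧
      (¬ HasGraph S x y → τ.arr 0 (∑ i : Fin k, (x i : ℕ) * m ^ (i : ℕ)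
        + m ^ k * ∑ i : Fin k, (y i : ℕ) * n ^ (i : ℕ)) = 0)

end CountingPresheaf

/-!
A section that survives in `cofp` is a winning position for Duplicator in the bijective `k`-pebble
game. A presheaf of partial isomorphisms whose sections all pass the bijection-game condition
(`IsStrategy`) is automatically flasque, because the bijections extend sections one element at a
time; hence it is contained in every iterate (`IsStrategy.le_cofp`). As a section is determined by
a listing of its graph of length `k`, the process is stationary after at most `(|A| |B| + 1) ^ k`
steps (`exists_cofpIter_eq_cofp`), so `cofp` is a fixpoint and is itself the greatest strategy
(`isStrategy_cofp`).

All comparisons then go through positions, i.e. sets of pairs contained in the graph of a section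
(`Covered`). From a strategy Duplicator can answer every move (`IsStrategy.extend`,
`IsStrategy.replace`); conversely, any set of placements of `k` pairs of pebbles within which every
move can be answered lies in `cofp` (`covered_cofp_of_placements`).

* For the logic, formulas are preserved along a strategy (`IsStrategy.realize_iff`), and the
  placements satisfying the same formulas allow Duplicator to answer (`SameFormulas.replace`): on
  the finite set `A ⊕ B` every type is isolated by one formula, and counting quantifiers equate the
  numbers of its realizations (`exists_equiv_of_card_eq`).
* For the `d`-dimensional Weisfeiler-Leman algorithm with `k = d + 1`, equality of multisets of
  colours is the existence of a colour-preserving bijection (`map_univ_eq_iff_exists_equiv`), and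
  one bijection works for all rounds because there are finitely many. A position of `d + 1` pairs is
  compared through the colours of the first `d` pairs and of the tuples that arise from them by
  substituting the last pair (`SameExtColor`).
* For the program, `cofp` is computed as the limit of the refinement `tupleIter` on pairs of
  `k`-tuples (`tupleIter_iff_covered`). All its stages are difunctional, so the bipartite graphs to
  be searched for perfect matchings are disjoint unions of complete ones, and comparing degrees
  suffices (`exists_equiv_iff_degreeCond`). It thus remains to evaluate terms built from bounded
  sums; such terms compile to polynomial-time programs (`Comp`, `DecPoly`), and one array filled by
  courses-of-values recursion holds all stages (`exists_fill`, `roundStep_iff`).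
-/

namespace CountingPresheaf

open FirstOrder.Language.Structure (RelMap)

/-! ### Strategies and the fixpoint of the process -/

section

variable {A : Type w} {B : Type w'} {k : ℕ}

/-- Duplicator strategies in the bijective `k`-pebble game: presheaves of partial isomorphisms all
of whose sections pass the bijection-game condition. -/
structure IsStrategy (L : FirstOrder.Language.{u, v}) [DecidableEq A] [L.Structure A]
    [L.Structure B] (S : Family A B k) : Prop where
  le_partialIsos : S ≤ partialIsos L A B k
  isPresheaf : IsPresheaf S
  cotest : ∀ C, ∀ s ∈ S C, Cotest S C s

theorem coflasq_le (S : Family A B k) : coflasq S ≤ S :=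
  fun C _ ⟨_, _, _, hTS, hs⟩ => hTS C hs

theorem isPresheaf_coflasq (S : Family A B k) : IsPresheaf (coflasq S) :=
  fun C' C h s ⟨T, hT, hT', hTS, hs⟩ => ⟨T, hT, hT', hTS, hT C' C h s hs⟩

theorem le_coflasq {S T : Family A B k} (hT : IsPresheaf T) (hT' : IsFlasque T) (h : T ≤ S) :
    T ≤ coflasq S :=
  fun _ _ hs => ⟨T, hT, hT', h, hs⟩

theorem Cotest.mono [DecidableEq A] {S T : Family A B k} (h : S ≤ T) {C : Sk A k} {s : C.1 → B}
    (hs : Cotest S C s) : Cotest T C s :=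
  fun hC => let ⟨t, h1, h2, h3⟩ := hs hC; ⟨t, fun a => h _ (h1 a), h2, h3⟩

/-- The bijection-game condition extends sections one element at a time, hence to every larger
domain. -/
theorem isFlasque_of_cotest [DecidableEq A] {S : Family A B k}
    (hS : ∀ C, ∀ s ∈ S C, Cotest S C s) : IsFlasque S := by
  suffices H : ∀ (n : ℕ) (C C' : Sk A k) (h : C.1 ⊆ C'.1), (C'.1 \ C.1).card = n → ∀ s ∈ S C,
      ∃ t ∈ S C', Finset.restrict₂ (π := fun _ => B) h t = s from
    fun C C' h s hs => H _ C C' h rfl s hs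
  intro n
  induction n with
  | zero =>
    intro C C' h hn s hs
    have hsub : C'.1 ⊆ C.1 := by
      rwa [Finset.card_eq_zero, Finset.sdiff_eq_empty_iff_subset] at hn
    obtain rfl : C = C' := Subtype.ext (h.antisymm hsub)
    exact ⟨s, hs, rfl⟩
  | succ n ih =>
    intro C C' h hn s hs
    obtain ⟨a, ha⟩ : (C'.1 \ C.1).Nonempty := by
      rw [← Finset.card_pos]; omega
    have ha' := Finset.mem_sdiff.1 ha
    have hC : C.1.card < k :=
      (Finset.card_lt_card ⟨h, fun h' => ha'.2 (h' ha'.1)⟩).trans_le C'.2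
    obtain ⟨t, ht, hts, -⟩ := hS C s hs hC
    have hsub : (Sk.insert C hC a).1 ⊆ C'.1 := Finset.insert_subset ha'.1 h
    obtain ⟨t', ht', h'⟩ := ih (Sk.insert C hC a) C' hsub (by
      have : C'.1 \ (Sk.insert C hC a).1 = (C'.1 \ C.1).erase a := by
        ext x; simp only [Sk.insert, Finset.mem_sdiff, Finset.mem_insert, Finset.mem_erase]; tauto
      rw [this, Finset.card_erase_of_mem ha, hn, Nat.add_sub_cancel]) (t a) (ht a)
    refine ⟨t', ht', ?_⟩
    rw [← hts a, ← h']
    rfl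

/-- A decreasing sequence of subsets of a finite type, in which every set is determined by its
predecessor, is constant from some index on that is at most the cardinality of the type. -/
theorem exists_stable {X : Type*} [Finite X] (U : ℕ → Set X) (hU : ∀ i, U (i + 1) ⊆ U i)
    (hstep : ∀ i, U (i + 1) = U i → U (i + 2) = U (i + 1)) :
    ∃ N ≤ Nat.card X, ∀ i ≥ N, U i = U N := by
  obtain ⟨N, hN, h⟩ : ∃ N ≤ Nat.card X, U (N + 1) = U N := by
    by_contra! hne
    have : ∀ i, i ≤ Nat.card X + 1 → (U i).ncard + i ≤ Nat.card X := by
      intro i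
      induction i with
      | zero => intro _; simpa using Set.ncard_le_card (U 0)
      | succ i ih =>
        intro hi
        have h1 := Set.ncard_lt_ncard ((hU i).ssubset_of_ne (hne i (by omega))) (Set.toFinite _)
        have h2 := ih (by omega)
        omega
    have := this _ le_rfl
    omega
  have hs : ∀ j, U (N + j + 1) = U (N + j) := by
    intro j
    induction j with
    | zero => exact h
    | succ j ih => exact hstep _ ih
  refine ⟨N, hN, fun i hi => ?_⟩
  obtain ⟨j, rfl⟩ := Nat.exists_eq_add_of_le hi
  induction j with
  | zero => rfl
  | succ j ih => rw [← ih (by omega)]; exact hs j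

/-- A finite set with at most `k` elements is listed by a partial map from `Fin k`. -/
theorem exists_listing {X : Type*} (F : Finset X) (h : F.card ≤ k) :
    ∃ p : Fin k → Option X, ∀ x, x ∈ F ↔ ∃ i, p i = some x := by
  refine ⟨fun i => if hi : (i : ℕ) < F.card then some (F.equivFin.symm ⟨i, hi⟩ : X) else none,
    fun x => ⟨fun hx => ?_, ?_⟩⟩
  · refine ⟨⟨F.equivFin ⟨x, hx⟩, (F.equivFin ⟨x, hx⟩).2.trans_le h⟩, ?_⟩
    simp
  · rintro ⟨i, hi⟩
    dsimp only at hi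
    split_ifs at hi with h'
    cases hi
    exact Subtype.prop _

/-- A section over at most `k` elements is determined by a listing of its graph of length `k`. -/
theorem card_sections_le [Fintype A] [Fintype B] :
    Nat.card (Σ C : Sk A k, (C.1 → B)) ≤ (Fintype.card A * Fintype.card B + 1) ^ k := by
  classical
  have hex : ∀ q : Σ C : Sk A k, (C.1 → B), ∃ p : Fin k → Option (A × B),
      ∀ x : A × B, (∃ h : x.1 ∈ q.1.1, q.2 ⟨x.1, h⟩ = x.2) ↔ ∃ i, p i = some x := by
    rintro ⟨C, s⟩
    obtain ⟨p, hp⟩ := exists_listing (k := k)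
      ((Finset.univ : Finset C.1).image fun c : C.1 => ((c : A), s c))
      (Finset.card_image_le.trans (by simpa using C.2))
    refine ⟨p, fun x => ?_⟩
    rw [← hp]
    rcases x with ⟨a, b⟩
    simp [Prod.ext_iff]
  choose p hp using hex
  have hinj : Function.Injective p := by
    rintro ⟨C, s⟩ ⟨C', s'⟩ h
    have key : ∀ a b, (∃ h : a ∈ C.1, s ⟨a, h⟩ = b) ↔ (∃ h : a ∈ C'.1, s' ⟨a, h⟩ = b) := by
      intro a b
      have h1 := hp ⟨C, s⟩ (a, b)
      have h2 := hp ⟨C', s'⟩ (a, b)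
      rw [h] at h1
      exact h1.trans h2.symm
    obtain rfl : C = C' := by
      refine Subtype.ext (Finset.ext fun a => ⟨fun ha => ?_, fun ha => ?_⟩)
      · exact ((key a _).1 ⟨ha, rfl⟩).1
      · exact ((key a _).2 ⟨ha, rfl⟩).1
    congr 1
    funext c
    obtain ⟨_, h'⟩ := (key c.1 _).1 ⟨c.2, rfl⟩
    exact h'.symm
  refine (Nat.card_le_card_of_injective p hinj).trans ?_
  simp

variable (L : FirstOrder.Language.{u, v}) [DecidableEq A] [L.Structure A] [L.Structure B]

theorem cofpIter_succ_le (i : ℕ) : cofpIter L A B k (i + 1) ≤ cofpIter L A B k i :=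
  (coflasq_le _).trans fun _ _ h => h.1

theorem IsStrategy.le_cofpIter {S : Family A B k} (hS : IsStrategy L S) (i : ℕ) :
    S ≤ cofpIter L A B k i := by
  have hfl := isFlasque_of_cotest hS.cotest
  induction i with
  | zero => exact le_coflasq hS.isPresheaf hfl hS.le_partialIsos
  | succ i ih =>
    exact le_coflasq hS.isPresheaf hfl fun C s hs => ⟨ih C hs, (hS.cotest C s hs).mono ih⟩

theorem IsStrategy.le_cofp {S : Family A B k} (hS : IsStrategy L S) : S ≤ cofp L A B k :=
  fun C _ hs => Set.mem_iInter.2 fun i => hS.le_cofpIter L i C hs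

theorem exists_cofpIter_eq_cofp [Fintype A] [Fintype B] :
    ∃ N ≤ (Fintype.card A * Fintype.card B + 1) ^ k,
      ∀ i ≥ N, cofpIter L A B k i = cofp L A B k := by
  let U : ℕ → Set (Σ C : Sk A k, (C.1 → B)) := fun i => {q | q.2 ∈ cofpIter L A B k i q.1}
  have hUinj : ∀ i j, U i = U j → cofpIter L A B k i = cofpIter L A B k j := by
    intro i j h
    funext C
    ext s
    exact Set.ext_iff.1 h ⟨C, s⟩
  obtain ⟨N, hN, h⟩ := exists_stable U (fun i q hq => cofpIter_succ_le L i q.1 hq)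
    (fun i hi => by
      have := hUinj _ _ hi
      have h2 : cofpIter L A B k (i + 2) = cofpIter L A B k (i + 1) :=
        congrArg (fun S => coflasq (cotestFilter S)) this
      simp only [U, h2])
  have hanti : Antitone (cofpIter L A B k) := antitone_nat_of_succ_le (cofpIter_succ_le L)
  have hst : ∀ i ≥ N, cofpIter L A B k i = cofpIter L A B k N := fun i hi => hUinj _ _ (h i hi)
  have hlim : cofp L A B k = cofpIter L A B k N := by
    refine le_antisymm (fun C => Set.iInter_subset _ N) fun C s hs => Set.mem_iInter.2 fun i => ?_
    rcases le_total i N with hi | hi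
    · exact hanti hi C hs
    · rw [hst i hi]; exact hs
  exact ⟨N, hN.trans card_sections_le, fun i hi => (hst i hi).trans hlim.symm⟩

theorem coflasq_cotestFilter_cofp [Fintype A] [Fintype B] :
    coflasq (cotestFilter (cofp L A B k)) = cofp L A B k := by
  obtain ⟨N, -, h⟩ := exists_cofpIter_eq_cofp (k := k) (A := A) (B := B) L
  have h1 := h (N + 1) (by omega)
  rw [← h N le_rfl] at h1 ⊢
  exact h1

theorem isStrategy_cofp [Fintype A] [Fintype B] : IsStrategy L (cofp L A B k) where
  le_partialIsos C _ hs := coflasq_le _ C (Set.mem_iInter.1 hs 0)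
  isPresheaf := by
    rw [← coflasq_cotestFilter_cofp]; exact isPresheaf_coflasq _
  cotest C s hs := by
    rw [← coflasq_cotestFilter_cofp] at hs
    exact (coflasq_le _ C hs).2

end

/-! ### Positions of the pebble game -/

section

variable {A : Type w} {B : Type w'} {k : ℕ}

/-- The set of pairs `g` is a partial isomorphism, given as a graph. -/
def IsPairIso (L : FirstOrder.Language.{u, v}) [L.Structure A] [L.Structure B]
    (g : Set (A × B)) : Prop :=
  (∀ x ∈ g, ∀ y ∈ g, x.1 = y.1 ↔ x.2 = y.2) ∧
    ∀ (n : ℕ) (R : L.Relations n) (x : Fin n → A × B), (∀ i, x i ∈ g) →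
      (RelMap R (fun i => (x i).1) ↔ RelMap R fun i => (x i).2)

/-- The set of pairs `g` is contained in the graph of a section of `S`. -/
def Covered (S : Family A B k) (g : Set (A × B)) : Prop :=
  ∃ C, ∃ s ∈ S C, ∀ x ∈ g, ∃ h : x.1 ∈ C.1, s ⟨x.1, h⟩ = x.2

/-- The pairs listed by a placement `p` of `k` pairs of pebbles. -/
def pairs {ι : Type*} (p : ι → Option (A × B)) : Set (A × B) := {x | ∃ i, p i = some x}

theorem Covered.mono {S : Family A B k} {g g' : Set (A × B)} (h : g ⊆ g') (hg : Covered S g') :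
    Covered S g :=
  let ⟨C, s, hs, h'⟩ := hg; ⟨C, s, hs, fun x hx => h' x (h hx)⟩

theorem covered_empty_iff {S : Family A B k} : Covered S ∅ ↔ S ≠ ⊥ := by
  constructor
  · rintro ⟨C, s, hs, -⟩ rfl
    exact hs
  · intro h
    by_contra hc
    refine h (funext fun C => Set.eq_empty_of_forall_notMem fun s hs => hc ⟨C, s, hs, ?_⟩)
    simp

theorem Covered.ne_bot {S : Family A B k} {g : Set (A × B)} (hg : Covered S g) : S ≠ ⊥ :=
  covered_empty_iff.1 (hg.mono (Set.empty_subset g))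

/-- The pairs of corresponding entries of two tuples. -/
def zipPairs {ι : Type*} (x : ι → A) (y : ι → B) : Set (A × B) := Set.range fun i => (x i, y i)

theorem pairs_some {ι : Type*} (x : ι → A) (y : ι → B) :
    pairs (fun i => some (x i, y i)) = zipPairs x y := by
  ext z; simp [pairs, zipPairs]

theorem update_some_pair {d : ℕ} (x : Fin d → A) (y : Fin d → B) (j : Fin d) (a : A) (b : B) :
    Function.update (fun i => some (x i, y i)) j (some (a, b)) =
      fun i => some (Function.update x j a i, Function.update y j b i) := by
  funext i
  by_cases h : i = j
  · subst h; simp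
  · simp [h]

variable {L : FirstOrder.Language.{u, v}} [L.Structure A] [L.Structure B]

theorem isPairIso_zipPairs_iff {d : ℕ} {x : Fin d → A} {y : Fin d → B} :
    IsPairIso L (zipPairs x y) ↔ atp L x = atp L y := by
  constructor
  · rintro ⟨h1, h2⟩
    simp only [atp, AtomicType.mk.injEq]
    refine ⟨?_, ?_⟩
    · funext i j
      exact propext (h1 _ ⟨i, rfl⟩ _ ⟨j, rfl⟩)
    · funext n R f
      exact propext (h2 n R (fun i => (x (f i), y (f i))) fun i => ⟨f i, rfl⟩)
  · intro h
    refine ⟨?_, fun n R z hz => ?_⟩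
    · rintro _ ⟨i, rfl⟩ _ ⟨j, rfl⟩
      exact iff_of_eq (congrFun (congrFun (congrArg AtomicType.eq h) i) j)
    · choose f hf using hz
      have := congrFun (congrFun (congrFun (congrArg AtomicType.rel h) n) R) f
      simp only [← hf]
      exact iff_of_eq this

variable [DecidableEq A]

theorem IsStrategy.isPairIso {S : Family A B k} (hS : IsStrategy L S) {g : Set (A × B)}
    (hg : Covered S g) : IsPairIso L g := by
  obtain ⟨C, s, hs, h⟩ := hg
  obtain ⟨hinj, hrel⟩ := hS.le_partialIsos C hs
  refine ⟨fun x hx y hy => ?_, fun n R x hx => ?_⟩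
  · obtain ⟨hx1, hx2⟩ := h x hx
    obtain ⟨hy1, hy2⟩ := h y hy
    rw [← hx2, ← hy2, hinj.eq_iff, Subtype.mk.injEq]
  · choose h1 h2 using fun i => h (x i) (hx i)
    have := hrel n R fun i => ⟨(x i).1, h1 i⟩
    simpa only [h2] using this

/-- From a position of fewer than `k` pairs, Duplicator has a bijection to answer with. -/
theorem IsStrategy.extend {S : Family A B k} (hS : IsStrategy L S) {g : Set (A × B)}
    (hg : Covered S g) (hcard : g.encard < k) :
    ∃ f : A ≃ B, ∀ a, Covered S (insert (a, f a) g) := by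
  classical
  obtain ⟨C, s, hs, h⟩ := hg
  -- Only the part of the domain that is occupied by `g` is kept.
  let D : Finset A := C.1.filter fun a => a ∈ Prod.fst '' g
  have hDC : D ⊆ C.1 := Finset.filter_subset _ _
  have hD : D.card < k := by
    have h1 : (D : Set A) ⊆ Prod.fst '' g := fun a ha => (Finset.mem_filter.1 ha).2
    have h2 := (Set.encard_le_encard h1).trans (Set.encard_image_le _ _)
    rw [Set.encard_coe_eq_coe_finsetCard] at h2
    exact_mod_cast h2.trans_lt hcard
  have hr := hS.isPresheaf ⟨D, hD.le⟩ C hDC s hs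
  obtain ⟨t, ht, hts, hbij⟩ := hS.cotest _ _ hr hD
  refine ⟨Equiv.ofBijective _ hbij, fun a => ⟨_, t a, ht a, ?_⟩⟩
  rintro x (rfl | hx)
  · exact ⟨Finset.mem_insert_self _ _, rfl⟩
  · obtain ⟨hxC, hx'⟩ := h x hx
    have hxD : x.1 ∈ D := Finset.mem_filter.2 ⟨hxC, x, hx, rfl⟩
    exact ⟨Finset.mem_insert_of_mem hxD, (congrFun (hts a) ⟨x.1, hxD⟩).trans hx'⟩

/-- Duplicator can answer when any one of the `k` pairs of pebbles is moved. -/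
theorem IsStrategy.replace {S : Family A B k} (hS : IsStrategy L S) {p : Fin k → Option (A × B)}
    (hp : Covered S (pairs p)) (j : Fin k) :
    ∃ f : A ≃ B, ∀ a, Covered S (pairs (Function.update p j (some (a, f a)))) := by
  have hsub : {x | ∃ i ≠ j, p i = some x} ⊆ pairs p := fun x ⟨i, _, hi⟩ => ⟨i, hi⟩
  obtain ⟨f, hf⟩ := hS.extend (hp.mono hsub) (by
    have h1 : some '' {x | ∃ i ≠ j, p i = some x} ⊆ p '' ({j}ᶜ : Set (Fin k)) := by
      rintro _ ⟨x, ⟨i, hij, hi⟩, rfl⟩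
      exact ⟨i, hij, hi⟩
    rw [← (Option.some_injective _).encard_image]
    refine ((Set.encard_le_encard h1).trans (Set.encard_image_le _ _)).trans_lt ?_
    have h2 : ({j}ᶜ : Set (Fin k)).encard < (Set.univ : Set (Fin k)).encard :=
      (Set.toFinite _).encard_lt_encard (Set.ssubset_univ_iff.2 (Set.compl_ne_univ.2 ⟨j, rfl⟩))
    simpa [Set.encard_univ] using h2)
  refine ⟨f, fun a => (hf a).mono ?_⟩
  rintro x ⟨i, hi⟩
  by_cases hij : i = j
  · subst hij
    rw [Function.update_self, Option.some_inj] at hi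
    exact Or.inl hi.symm
  · rw [Function.update_of_ne hij] at hi
    exact Or.inr ⟨i, hij, hi⟩

/-- A set of pebble placements in which Duplicator can always answer yields a strategy: the
sections whose graph is contained in such a placement. -/
theorem covered_cofp_of_placements {Q : (Fin k → Option (A × B)) → Prop}
    (hiso : ∀ p, Q p → IsPairIso L (pairs p))
    (hrep : ∀ p, Q p → ∀ j, ∃ f : A ≃ B, ∀ a, Q (Function.update p j (some (a, f a))))
    {p : Fin k → Option (A × B)} (hp : Q p) : Covered (cofp L A B k) (pairs p) := by
  classical
  let T : Family A B k := fun C => {s | ∃ p, Q p ∧ ∀ c : C.1, ∃ i, p i = some (c.1, s c)}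
  have hT : IsStrategy L T := by
    constructor
    · rintro C s ⟨p, hp, h⟩
      obtain ⟨h1, h2⟩ := hiso p hp
      refine ⟨fun c c' hcc => Subtype.ext ((h1 _ (h c) _ (h c')).2 hcc), fun n R x => ?_⟩
      exact h2 n R (fun i => ((x i).1, s (x i))) fun i => h (x i)
    · rintro C' C h s ⟨p, hp, h'⟩
      exact ⟨p, hp, fun c => h' ⟨c.1, h c.2⟩⟩
    · rintro C s ⟨p, hp, h⟩ hC
      choose i hi using h
      -- Some pair of pebbles is not needed to cover the graph of `s`.
      obtain ⟨j, hj⟩ : ∃ j, ∀ c, i c ≠ j := by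
        by_contra! hsurj
        have := Fintype.card_le_of_surjective i hsurj
        simp at this
        omega
      obtain ⟨f, hf⟩ := hrep p hp j
      have hcov : ∀ a, ∀ c : C.1,
          ((c : A), s c) ∈ pairs (Function.update p j (some (a, f a))) := fun a c =>
        ⟨i c, by rw [Function.update_of_ne (hj c), hi]⟩
      have hnew : ∀ a, (a, f a) ∈ pairs (Function.update p j (some (a, f a))) := fun a =>
        ⟨j, Function.update_self ..⟩
      let t : (a : A) → (Sk.insert C hC a).1 → B := fun a c =>
        if hc : c.1 ∈ C.1 then s ⟨c.1, hc⟩ else f a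
      have hself : ∀ a, t a ⟨a, Finset.mem_insert_self a C.1⟩ = f a := by
        intro a
        by_cases ha : a ∈ C.1
        · simp only [t, ha, dif_pos]
          exact ((hiso _ (hf a)).1 _ (hcov a ⟨a, ha⟩) _ (hnew a)).1 rfl
        · simp only [t, ha, dif_neg, not_false_iff]
      refine ⟨t, fun a => ⟨_, hf a, fun c => ?_⟩, fun a => ?_, ?_⟩
      · by_cases hc : c.1 ∈ C.1
        · have := hcov a ⟨c.1, hc⟩
          simp only [t, hc, dif_pos]
          exact this
        · obtain ⟨c, hc'⟩ := c
          obtain rfl : c = a := (Finset.mem_insert.1 hc').resolve_right hc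
          rw [hself]
          exact hnew c
      · funext c
        exact dif_pos c.2
      · simp only [hself]
        exact f.bijective
  have hpairs : ∀ x ∈ pairs p, ∀ y ∈ pairs p, x.1 = y.1 ↔ x.2 = y.2 := (hiso p hp).1
  let C : Sk A k := ⟨((Finset.univ.image p).eraseNone).image Prod.fst,
    Finset.card_image_le.trans ((Finset.card_eraseNone_le _).trans
      (Finset.card_image_le.trans (by simp)))⟩
  have hC : ∀ a, a ∈ C.1 ↔ ∃ b, (a, b) ∈ pairs p := by simp [C, pairs]
  choose s hs using fun c : C.1 => (hC c).1 c.2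
  refine ⟨C, s, hT.le_cofp L C ⟨p, hp, hs⟩, ?_⟩
  rintro ⟨a, b⟩ hab
  have ha : a ∈ C.1 := (hC a).2 ⟨b, hab⟩
  exact ⟨ha, (hpairs _ (hs ⟨a, ha⟩) (a, b) hab).1 rfl⟩

/-- The case of placements in which all `k` pairs of pebbles are on the board. -/
theorem covered_cofp_of_tuples {Q : (Fin k → A) → (Fin k → B) → Prop}
    (hiso : ∀ x y, Q x y → atp L x = atp L y)
    (hrep : ∀ x y, Q x y → ∀ j, ∃ f : A ≃ B, ∀ a,
      Q (Function.update x j a) (Function.update y j (f a)))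
    {x : Fin k → A} {y : Fin k → B} (h : Q x y) : Covered (cofp L A B k) (zipPairs x y) := by
  rw [← pairs_some]
  refine covered_cofp_of_placements
    (Q := fun p => ∃ x y, Q x y ∧ p = fun i => some (x i, y i)) ?_ ?_ ⟨x, y, h, rfl⟩
  · rintro _ ⟨x, y, h, rfl⟩
    rw [pairs_some, isPairIso_zipPairs_iff]
    exact hiso x y h
  · rintro _ ⟨x, y, h, rfl⟩ j
    obtain ⟨f, hf⟩ := hrep x y h j
    exact ⟨f, fun a => ⟨_, _, hf a, update_some_pair x y j a (f a)⟩⟩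

theorem IsStrategy.replace_tuple {S : Family A B k} (hS : IsStrategy L S) {x : Fin k → A}
    {y : Fin k → B} (h : Covered S (zipPairs x y)) (j : Fin k) :
    ∃ f : A ≃ B, ∀ a,
      Covered S (zipPairs (Function.update x j a) (Function.update y j (f a))) := by
  rw [← pairs_some] at h
  obtain ⟨f, hf⟩ := hS.replace h j
  refine ⟨f, fun a => ?_⟩
  rw [← pairs_some, ← update_some_pair]
  exact hf a

end

/-! ### Bijections that preserve colours -/

section

variable {A : Type w} {B : Type w'}

theorem exists_equiv_of_card_fiber_eq [Finite A] [Finite B] {K : Type*} {c : A → K} {d : B → K}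
    (h : ∀ q, Nat.card {a // c a = q} = Nat.card {b // d b = q}) :
    ∃ f : A ≃ B, ∀ a, d (f a) = c a := by
  have e : ∀ q, Nonempty ({a // c a = q} ≃ {b // d b = q}) := fun q =>
    Finite.card_eq.1 (h q)
  have e := fun q => (e q).some
  refine ⟨((Equiv.sigmaFiberEquiv c).symm.trans (Equiv.sigmaCongrRight e)).trans
    (Equiv.sigmaFiberEquiv d), fun a => ?_⟩
  exact (e (c a) ⟨a, rfl⟩).2

theorem map_univ_eq_iff_exists_equiv [Fintype A] [Fintype B] {K : Type*} {c : A → K}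
    {d : B → K} :
    (Finset.univ : Finset A).val.map c = (Finset.univ : Finset B).val.map d ↔
      ∃ f : A ≃ B, ∀ a, d (f a) = c a := by
  classical
  constructor
  · intro h
    refine exists_equiv_of_card_fiber_eq fun q => ?_
    have := congrArg (Multiset.count q) h
    simp only [Multiset.count_map] at this
    simp only [Nat.card_eq_fintype_card, Fintype.card_subtype]
    simpa [Finset.card_def, eq_comm] using this
  · rintro ⟨f, hf⟩
    rw [← Multiset.map_univ_val_equiv f, Multiset.map_map]
    exact Multiset.map_congr rfl fun a _ => (hf a).symm

end

/-! ### Counting logic -/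

section

variable {A : Type w} {B : Type w'} {k : ℕ}

/-- If a set of properties of the elements of `A` and `B` is closed under negation and conjunction,
and each property has equally many instances in `A` and in `B`, then there is a bijection that
preserves all these properties: on the finite set `A ⊕ B`, each type is isolated by a single
property. -/
theorem exists_equiv_of_card_eq [Finite A] [Finite B] {Φ : Type*} [Nonempty Φ]
    {P : Φ → A ⊕ B → Prop} (hneg : ∀ φ, ∃ ψ, ∀ x, P ψ x ↔ ¬ P φ x)
    (hconj : ∀ φ φ', ∃ ψ, ∀ x, P ψ x ↔ P φ x ∧ P φ' x)
    (hcard : ∀ φ, Nat.card {a // P φ (.inl a)} = Nat.card {b // P φ (.inr b)}) :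
    ∃ f : A ≃ B, ∀ a φ, P φ (.inl a) ↔ P φ (.inr (f a)) := by
  classical
  have := Fintype.ofFinite (A ⊕ B)
  have hiso : ∀ x₀, ∃ φ, ∀ x, P φ x ↔ ∀ ψ, P ψ x ↔ P ψ x₀ := by
    intro x₀
    have : ∀ s : Finset (A ⊕ B), ∃ φ, P φ x₀ ∧ ∀ x ∈ s, P φ x → ∀ ψ, P ψ x ↔ P ψ x₀ := by
      intro s
      induction s using Finset.induction_on with
      | empty =>
        obtain ⟨φ⟩ := ‹Nonempty Φ›
        by_cases h : P φ x₀
        · exact ⟨φ, h, by simp⟩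
        · obtain ⟨ψ, hψ⟩ := hneg φ
          exact ⟨ψ, (hψ _).2 h, by simp⟩
      | insert y s _ ih =>
        obtain ⟨φ, hφ, hs⟩ := ih
        by_cases hy : ∀ ψ, P ψ y ↔ P ψ x₀
        · refine ⟨φ, hφ, fun x hx hPx => ?_⟩
          rcases Finset.mem_insert.1 hx with rfl | hx
          · exact hy
          · exact hs x hx hPx
        · obtain ⟨ψ, hψ, hψy⟩ : ∃ ψ, P ψ x₀ ∧ ¬ P ψ y := by
            push Not at hy
            obtain ⟨ψ, h | h⟩ := hy
            · obtain ⟨ψ', hψ'⟩ := hneg ψ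
              exact ⟨ψ', (hψ' _).2 h.2, fun h' => (hψ' _).1 h' h.1⟩
            · exact ⟨ψ, h.2, h.1⟩
          obtain ⟨χ, hχ⟩ := hconj φ ψ
          refine ⟨χ, (hχ _).2 ⟨hφ, hψ⟩, fun x hx hPx => ?_⟩
          rcases Finset.mem_insert.1 hx with rfl | hx
          · exact absurd ((hχ _).1 hPx).2 hψy
          · exact hs x hx ((hχ _).1 hPx).1
    obtain ⟨φ, hφ, h⟩ := this Finset.univ
    exact ⟨φ, fun x => ⟨h x (Finset.mem_univ x), fun hx => (hx φ).2 hφ⟩⟩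
  let c : A ⊕ B → Set Φ := fun x => {φ | P φ x}
  have hc : ∀ x y, c x = c y ↔ ∀ ψ, P ψ x ↔ P ψ y := fun x y => Set.ext_iff
  obtain ⟨f, hf⟩ := exists_equiv_of_card_fiber_eq (c := fun a : A => c (.inl a))
    (d := fun b : B => c (.inr b)) (fun q => by
      by_cases hq : ∃ x, c x = q
      · obtain ⟨x, rfl⟩ := hq
        obtain ⟨φ, hφ⟩ := hiso x
        simp only [hc, ← hφ]
        exact hcard φ
      · push Not at hq
        have : IsEmpty {a : A // c (.inl a) = q} := ⟨fun a => hq _ a.2⟩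
        have : IsEmpty {b : B // c (.inr b) = q} := ⟨fun b => hq _ b.2⟩
        rw [Nat.card_of_isEmpty, Nat.card_of_isEmpty])
  exact ⟨f, fun a => ((hc _ _).1 (hf a).symm)⟩

variable {L : FirstOrder.Language.{u, v}} [L.Structure A] [L.Structure B]

/-- The placement of the left or right pebbles of a placement of pairs. -/
def proj {X Y : Type*} (π : X → Y) (p : Fin k → Option X) : Fin k → Option Y :=
  fun i => (p i).map π

theorem proj_update {X Y : Type*} (π : X → Y) (p : Fin k → Option X) (j : Fin k) (x : X) :
    proj π (Function.update p j (some x)) = Function.update (proj π p) j (some (π x)) := by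
  funext i
  by_cases h : i = j
  · subst h; simp [proj]
  · simp [proj, h]

theorem CFormula.realize_equal_proj {X : Type*} (π : X → A) (p : Fin k → Option X) (x y : Fin k) :
    (CFormula.equal (L := L) x y).Realize (proj π p) ↔
      ∃ u v, p x = some u ∧ p y = some v ∧ π u = π v := by
  simp only [CFormula.Realize, proj, Option.map_eq_some_iff]
  constructor
  · rintro ⟨a, ⟨u, hu, rfl⟩, v, hv, h⟩
    exact ⟨u, v, hu, hv, h.symm⟩
  · rintro ⟨u, v, hu, hv, h⟩
    exact ⟨π u, ⟨u, hu, rfl⟩, v, hv, h.symm⟩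

theorem CFormula.realize_rel_proj {X : Type*} (π : X → A) (p : Fin k → Option X) {n : ℕ}
    (R : L.Relations n) (x : Fin n → Fin k) :
    (CFormula.rel R x).Realize (proj π p) ↔
      ∃ u : Fin n → X, (∀ i, p (x i) = some (u i)) ∧ RelMap R fun i => π (u i) := by
  simp only [CFormula.Realize, proj, Option.map_eq_some_iff]
  constructor
  · rintro ⟨a, ha, hR⟩
    choose u hu hua using ha
    exact ⟨u, hu, by simpa only [hua] using hR⟩
  · rintro ⟨u, hu, hR⟩
    exact ⟨_, fun i => ⟨u i, hu i, rfl⟩, hR⟩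

/-- Positions reached under a strategy satisfy the same formulas on both sides. -/
theorem IsStrategy.realize_iff [DecidableEq A] {S : Family A B k} (hS : IsStrategy L S)
    (φ : CFormula L k) {p : Fin k → Option (A × B)} (hp : Covered S (pairs p)) :
    φ.Realize (proj Prod.fst p) ↔ φ.Realize (proj Prod.snd p) := by
  induction φ generalizing p with
  | falsum => rfl
  | equal x y =>
    simp only [CFormula.realize_equal_proj]
    refine exists₂_congr fun u v => and_congr_right fun hu => and_congr_right fun hv => ?_
    exact (hS.isPairIso hp).1 u ⟨x, hu⟩ v ⟨y, hv⟩
  | rel R x =>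
    simp only [CFormula.realize_rel_proj]
    refine exists_congr fun u => and_congr_right fun hu => ?_
    exact (hS.isPairIso hp).2 _ R u fun i => ⟨x i, hu i⟩
  | neg φ ih => exact not_congr (ih hp)
  | conj φ ψ ih ih' => exact and_congr (ih hp) (ih' hp)
  | existsGE m x φ ih =>
    obtain ⟨f, hf⟩ := hS.replace hp x
    have h : ∀ a, φ.Realize (Function.update (proj Prod.fst p) x (some a)) ↔
        φ.Realize (Function.update (proj Prod.snd p) x (some (f a))) := by
      intro a
      have := ih (hf a)
      rwa [proj_update, proj_update] at this
    exact iff_of_eq (congrArg (m ≤ ·) (Nat.card_congr (Equiv.subtypeEquiv f h)))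

/-- Both sides of the placement `p` satisfy the same formulas whose free variables are placed. -/
def SameFormulas (L : FirstOrder.Language.{u, v}) [L.Structure A] [L.Structure B]
    (p : Fin k → Option (A × B)) : Prop :=
  ∀ φ : CFormula L k, (∀ x ∈ φ.freeVars, (p x).isSome) →
    (φ.Realize (proj Prod.fst p) ↔ φ.Realize (proj Prod.snd p))

theorem SameFormulas.isPairIso {p : Fin k → Option (A × B)} (hp : SameFormulas L p) :
    IsPairIso L (pairs p) := by
  constructor
  · rintro x ⟨i, hi⟩ y ⟨j, hj⟩
    have := hp (.equal i j) (by simp [CFormula.freeVars, hi, hj])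
    simpa [CFormula.realize_equal_proj, hi, hj] using this
  · intro n R x hx
    choose i hi using hx
    have := hp (.rel R i) (by simp [CFormula.freeVars, hi])
    simp only [CFormula.realize_rel_proj, hi, Option.some_inj] at this
    constructor
    · intro h
      obtain ⟨u, hu, hR⟩ := this.1 ⟨x, fun _ => rfl, h⟩
      obtain rfl : x = u := funext hu
      exact hR
    · intro h
      obtain ⟨u, hu, hR⟩ := this.2 ⟨x, fun _ => rfl, h⟩
      obtain rfl : x = u := funext hu
      exact hR

theorem SameFormulas.replace [Finite A] [Finite B] {p : Fin k → Option (A × B)}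
    (hp : SameFormulas L p) (j : Fin k) :
    ∃ f : A ≃ B, ∀ a, SameFormulas L (Function.update p j (some (a, f a))) := by
  let Φ := {φ : CFormula L k // ∀ x ∈ φ.freeVars, x ≠ j → (p x).isSome}
  have : Nonempty Φ := ⟨⟨.falsum, by simp [CFormula.freeVars]⟩⟩
  let P : Φ → A ⊕ B → Prop := fun φ => Sum.elim
    (fun a => φ.1.Realize (Function.update (proj Prod.fst p) j (some a)))
    (fun b => φ.1.Realize (Function.update (proj Prod.snd p) j (some b)))
  obtain ⟨f, hf⟩ := exists_equiv_of_card_eq (P := P)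
    (fun φ => ⟨⟨.neg φ.1, φ.2⟩, by rintro (x | x) <;> rfl⟩)
    (fun φ φ' => ⟨⟨.conj φ.1 φ'.1, fun x hx =>
      (Finset.mem_union.1 hx).elim (φ.2 x) (φ'.2 x)⟩, by rintro (x | x) <;> rfl⟩)
    (fun φ => by
      have h : ∀ m, m ≤ Nat.card {a // P φ (.inl a)} ↔ m ≤ Nat.card {b // P φ (.inr b)} :=
        fun m => hp (.existsGE m j φ.1) fun x hx =>
          φ.2 x (Finset.mem_of_mem_erase hx) (Finset.ne_of_mem_erase hx)
      exact le_antisymm ((h _).1 le_rfl) ((h _).2 le_rfl))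
  refine ⟨f, fun a φ hφ => ?_⟩
  have := hf a ⟨φ, fun x hx hxj => by simpa [hxj] using hφ x hx⟩
  rw [proj_update, proj_update]
  exact this

theorem cofp_ne_bot_iff_countingEquiv [Fintype A] [DecidableEq A] [Fintype B] :
    cofp L A B k ≠ ⊥ ↔ CountingEquiv L A B k := by
  have hnone : pairs (fun _ : Fin k => (none : Option (A × B))) = ∅ := by
    ext; simp [pairs]
  constructor
  · intro h φ _
    rw [← covered_empty_iff, ← hnone] at h
    exact (isStrategy_cofp L).realize_iff φ h
  · intro h
    have : SameFormulas L (fun _ : Fin k => (none : Option (A × B))) := fun φ hφ =>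
      h φ (Finset.eq_empty_of_forall_notMem fun x hx => by simpa using hφ x hx)
    exact (covered_cofp_of_placements (fun _ => SameFormulas.isPairIso)
      (fun _ => SameFormulas.replace) this).ne_bot

end

/-! ### The Weisfeiler-Leman algorithm -/

section

variable {A : Type w} {B : Type w'} {d : ℕ}

theorem exists_forall_of_forall_exists {X : Type*} [Finite X] {P : ℕ → X → Prop}
    (hP : ∀ i x, P (i + 1) x → P i x) (hex : ∀ i, ∃ x, P i x) : ∃ x, ∀ i, P i x := by
  by_contra! h
  choose i hi using h
  have hanti : ∀ x, Antitone fun i => P i x := fun x => antitone_nat_of_succ_le fun i => hP i x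
  obtain ⟨N, hN⟩ := (Set.finite_range i).bddAbove
  obtain ⟨x, hx⟩ := hex N
  exact hi x (hanti x (hN ⟨x, rfl⟩) hx)

theorem zipPairs_snoc (x : Fin d → A) (y : Fin d → B) (a : A) (b : B) :
    zipPairs (Fin.snoc (α := fun _ => A) x a) (Fin.snoc (α := fun _ => B) y b) =
      insert (a, b) (zipPairs x y) := by
  ext z
  simp only [zipPairs, Set.mem_range, Set.mem_insert_iff, Fin.exists_fin_succ', Fin.snoc_castSucc,
    Fin.snoc_last]
  rw [or_comm, eq_comm]

theorem zipPairs_update_subset (x : Fin d → A) (y : Fin d → B) (j : Fin d) (a : A) (b : B) :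
    zipPairs (Function.update x j a) (Function.update y j b) ⊆ insert (a, b) (zipPairs x y) := by
  rintro _ ⟨i, rfl⟩
  by_cases h : i = j
  · subst h; simp
  · exact Or.inr ⟨i, by simp [h]⟩

theorem encard_zipPairs_le (x : Fin d → A) (y : Fin d → B) : (zipPairs x y).encard ≤ d := by
  rw [zipPairs, ← Set.image_univ]
  exact (Set.encard_image_le _ _).trans (by simp [Set.encard_univ])

variable {L : FirstOrder.Language.{u, v}} [L.Structure A] [L.Structure B]

theorem IsPairIso.mono {g g' : Set (A × B)} (h : g ⊆ g') (hg : IsPairIso L g') : IsPairIso L g :=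
  ⟨fun x hx y hy => hg.1 x (h hx) y (h hy), fun n R x hx => hg.2 n R x fun i => h (hx i)⟩

/-- Playing a strategy from the empty position for `l` rounds pairs off the `l`-tuples. -/
theorem IsStrategy.exists_equiv_tuples [DecidableEq A] {k : ℕ} {S : Family A B k}
    (hS : IsStrategy L S) (h : Covered S ∅) (l : ℕ) (hl : l ≤ k) :
    ∃ F : (Fin l → A) ≃ (Fin l → B), ∀ x, Covered S (zipPairs x (F x)) := by
  induction l with
  | zero =>
    refine ⟨Equiv.ofUnique _ _, fun x => h.mono ?_⟩
    simp [zipPairs]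
  | succ l ih =>
    obtain ⟨F, hF⟩ := ih (by omega)
    have := fun x => hS.extend (hF x)
      ((encard_zipPairs_le x (F x)).trans_lt (by exact_mod_cast hl))
    choose f hf using this
    refine ⟨(((Fin.snocEquiv fun _ => A).symm.trans (Equiv.prodComm _ _)).trans
      (Equiv.prodShear F f)).trans ((Equiv.prodComm _ _).trans (Fin.snocEquiv fun _ => B)),
      fun z => ?_⟩
    obtain ⟨⟨a, x⟩, rfl⟩ := (Fin.snocEquiv fun _ => A).surjective z
    have := hf x a
    rw [← zipPairs_snoc] at this
    simpa [Fin.snocEquiv, Equiv.prodShear] using this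

variable [Fintype A] [Fintype B]

theorem wlColor_succ_eq_iff {i : ℕ} {x : Fin d → A} {y : Fin d → B} :
    wlColor L (i + 1) x = wlColor L (i + 1) y ↔ wlColor L i x = wlColor L i y ∧
      ∃ f : A ≃ B, ∀ a, IsPairIso L (insert (a, f a) (zipPairs x y)) ∧
        ∀ j, wlColor L i (Function.update x j a) = wlColor L i (Function.update y j (f a)) := by
  refine (Prod.ext_iff (α := WLColor L d i)).trans
    (and_congr_right' (map_univ_eq_iff_exists_equiv.trans (exists_congr fun f => forall_congr'
      fun a => Prod.ext_iff.trans (and_congr ?_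
        (funext_iff.trans (forall_congr' fun _ => eq_comm))))))
  rw [← zipPairs_snoc, isPairIso_zipPairs_iff, eq_comm]

/-- The tuples `x` and `y` have the same colour in every round. -/
def SameColor (L : FirstOrder.Language.{u, v}) [L.Structure A] [L.Structure B] (x : Fin d → A)
    (y : Fin d → B) : Prop :=
  ∀ i, wlColor L i x = wlColor L i y

theorem SameColor.exists_equiv {x : Fin d → A} {y : Fin d → B} (h : SameColor L x y) :
    ∃ f : A ≃ B, ∀ a, IsPairIso L (insert (a, f a) (zipPairs x y)) ∧
      ∀ j, SameColor L (Function.update x j a) (Function.update y j (f a)) := by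
  -- As there are finitely many bijections, one of them works in all rounds.
  obtain ⟨f, hf⟩ := exists_forall_of_forall_exists
    (P := fun i (f : A ≃ B) => ∀ a, IsPairIso L (insert (a, f a) (zipPairs x y)) ∧
      ∀ j, wlColor L i (Function.update x j a) = wlColor L i (Function.update y j (f a)))
    (fun i f hf a => ⟨(hf a).1, fun j => (wlColor_succ_eq_iff.1 ((hf a).2 j)).1⟩)
    (fun i => (wlColor_succ_eq_iff.1 (h (i + 1))).2)
  exact ⟨f, fun a => ⟨(hf 0 a).1, fun j i => (hf i a).2 j⟩⟩

theorem wlColor_comp_perm {i : ℕ} {x : Fin d → A} {y : Fin d → B}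
    (h : wlColor L i x = wlColor L i y) (π : Equiv.Perm (Fin d)) :
    wlColor L i (x ∘ π) = wlColor L i (y ∘ π) := by
  have hsub : ∀ (x : Fin d → A) (y : Fin d → B), zipPairs (x ∘ π) (y ∘ π) ⊆ zipPairs x y := by
    rintro x y _ ⟨i, rfl⟩
    exact ⟨π i, rfl⟩
  induction i generalizing x y with
  | zero =>
    exact isPairIso_zipPairs_iff.1 ((isPairIso_zipPairs_iff.2 h).mono (hsub x y))
  | succ i ih =>
    obtain ⟨h1, f, hf⟩ := wlColor_succ_eq_iff.1 h
    refine wlColor_succ_eq_iff.2 ⟨ih h1, f, fun a => ⟨(hf a).1.mono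
      (Set.insert_subset_insert (hsub x y)), fun j => ?_⟩⟩
    have := ih ((hf a).2 (π j))
    simpa only [Function.update_comp_equiv, Equiv.symm_apply_apply] using this

theorem SameColor.comp_perm {x : Fin d → A} {y : Fin d → B} (h : SameColor L x y)
    (π : Equiv.Perm (Fin d)) : SameColor L (x ∘ π) (y ∘ π) :=
  fun i => wlColor_comp_perm (h i) π

variable [DecidableEq A]

theorem IsStrategy.sameColor {S : Family A B (d + 1)} (hS : IsStrategy L S) {x : Fin d → A}
    {y : Fin d → B} (h : Covered S (zipPairs x y)) : SameColor L x y := by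
  intro i
  induction i generalizing x y with
  | zero => exact isPairIso_zipPairs_iff.1 (hS.isPairIso h)
  | succ i ih =>
    obtain ⟨f, hf⟩ := hS.extend h
      ((encard_zipPairs_le x y).trans_lt (by exact_mod_cast Nat.lt_succ_self d))
    exact wlColor_succ_eq_iff.2 ⟨ih h, f, fun a => ⟨hS.isPairIso (hf a), fun j =>
      ih ((hf a).mono (zipPairs_update_subset x y j a (f a)))⟩⟩

/-- The positions of the `d + 1`-pebble game that the `d`-dimensional algorithm cannot tell apart:
the last pebble refines the colour of the tuple of the others. -/
def SameExtColor (L : FirstOrder.Language.{u, v}) [L.Structure A] [L.Structure B]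
    (z : Fin (d + 1) → A) (t : Fin (d + 1) → B) : Prop :=
  SameColor L (Fin.init z) (Fin.init t) ∧ atp L z = atp L t ∧
    ∀ j, SameColor L (Function.update (Fin.init z) j (z (Fin.last d)))
      (Function.update (Fin.init t) j (t (Fin.last d)))

omit [DecidableEq A] in
theorem SameColor.snoc {x : Fin d → A} {y : Fin d → B} (h : SameColor L x y) :
    ∃ f : A ≃ B, ∀ a, SameExtColor L (Fin.snoc (α := fun _ => A) x a)
      (Fin.snoc (α := fun _ => B) y (f a)) := by
  obtain ⟨f, hf⟩ := h.exists_equiv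
  refine ⟨f, fun a => ⟨by simpa using h, ?_, by simpa using (hf a).2⟩⟩
  rw [← isPairIso_zipPairs_iff, zipPairs_snoc]
  exact (hf a).1

theorem update_update_eq_comp_swap {X : Type*} (x : Fin d → X) {j l : Fin d} (h : l ≠ j)
    (a a' : X) : Function.update (Function.update x j a') l a =
      Function.update (Function.update x j a) l a' ∘ Equiv.swap j l := by
  funext i
  simp only [Function.comp, Equiv.swap_apply_def, Function.update_apply]
  grind

omit [DecidableEq A] in
theorem SameExtColor.replace {z : Fin (d + 1) → A} {t : Fin (d + 1) → B}
    (h : SameExtColor L z t) (j : Fin (d + 1)) :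
    ∃ f : A ≃ B, ∀ a, SameExtColor L (Function.update z j a) (Function.update t j (f a)) := by
  obtain ⟨h1, h2, h3⟩ := h
  induction j using Fin.lastCases with
  | last =>
    obtain ⟨f, hf⟩ := h1.snoc
    refine ⟨f, fun a => ?_⟩
    have := hf a
    rwa [← Fin.update_snoc_last (p := Fin.init z) (x := z (Fin.last d)),
      ← Fin.update_snoc_last (p := Fin.init t) (x := t (Fin.last d)),
      Fin.snoc_init_self, Fin.snoc_init_self] at this
  | cast j =>
    -- The new position is, up to order, an extension of the position with entry `j` replaced by
    -- the last entry.
    obtain ⟨f, hf⟩ := (h3 j).exists_equiv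
    refine ⟨f, fun a => ⟨?_, ?_, fun l => ?_⟩⟩
    · simpa only [Fin.init_update_castSucc, Function.update_idem] using (hf a).2 j
    · rw [← isPairIso_zipPairs_iff]
      refine (hf a).1.mono ?_
      rintro _ ⟨i, rfl⟩
      induction i using Fin.lastCases with
      | last =>
        refine Or.inr ⟨j, ?_⟩
        simp [Function.update_of_ne (Fin.castSucc_lt_last j).ne']
      | cast i =>
        by_cases hij : i = j
        · subst hij; simp
        · refine Or.inr ⟨i, ?_⟩
          simp [hij, Fin.init]
    · rw [Fin.init_update_castSucc, Fin.init_update_castSucc,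
        Function.update_of_ne (Fin.castSucc_lt_last j).ne',
        Function.update_of_ne (Fin.castSucc_lt_last j).ne']
      by_cases hlj : l = j
      · subst hlj
        simpa only [Function.update_idem] using h3 l
      · rw [update_update_eq_comp_swap (Fin.init z) hlj,
          update_update_eq_comp_swap (Fin.init t) hlj]
        exact ((hf a).2 l).comp_perm _

theorem cofp_ne_bot_iff_wlEquiv [Nonempty A] :
    cofp L A B (d + 1) ≠ ⊥ ↔ WLEquiv L A B d := by
  constructor
  · intro h i
    have hS := isStrategy_cofp (A := A) (B := B) (k := d + 1) L
    obtain ⟨F, hF⟩ := hS.exists_equiv_tuples (covered_empty_iff.2 h) d (by omega)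
    exact map_univ_eq_iff_exists_equiv.2 ⟨F, fun x => (hS.sameColor (hF x) i).symm⟩
  · intro h
    obtain ⟨a⟩ := ‹Nonempty A›
    obtain ⟨y, hy⟩ := exists_forall_of_forall_exists
      (P := fun i (y : Fin d → B) => wlColor L i (fun _ => a) = wlColor L i y)
      (fun i y h => (wlColor_succ_eq_iff.1 h).1) fun i => by
        obtain ⟨F, hF⟩ := map_univ_eq_iff_exists_equiv.1 (h i)
        exact ⟨_, (hF _).symm⟩
    obtain ⟨f, hf⟩ := SameColor.snoc hy
    exact (covered_cofp_of_tuples (fun _ _ h => h.2.1) (fun _ _ h => h.replace) (hf a)).ne_bot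

end

/-! ### Running programs -/

/-- The state `σ` with the value of the variable `x` changed to `v`. -/
def RamState.set (σ : RamState) (x v : ℕ) : RamState :=
  { σ with var := Function.update σ.var x v }

theorem RamState.var_set_self (σ : RamState) (x v : ℕ) : (σ.set x v).var x = v :=
  Function.update_self ..

theorem RamState.var_set_ne {σ : RamState} {x v y : ℕ} (h : y ≠ x) :
    (σ.set x v).var y = σ.var y :=
  Function.update_of_ne h ..

/-- Started in state `σ`, the program `p` halts after at most `T` steps in a state that
satisfies `R`. -/
def Runs (p : RamProg) (σ : RamState) (T : ℕ) (R : RamState → Prop) : Prop :=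
  ∃ t τ, Exec p σ t τ ∧ t ≤ T ∧ R τ

section

variable {p q : RamProg} {σ : RamState} {T T' : ℕ} {R R' : RamState → Prop}

theorem Runs.mono (h : Runs p σ T R) (hT : T ≤ T') (hR : ∀ τ, R τ → R' τ) : Runs p σ T' R' :=
  let ⟨t, τ, h1, h2, h3⟩ := h; ⟨t, τ, h1, h2.trans hT, hR τ h3⟩

theorem Runs.assign {x : ℕ} {e : RamExpr}
    (h : R (σ.set x (e.eval σ))) :
    Runs (.assign x e) σ (e.cost + 1) R :=
  ⟨_, _, Exec.assign x e σ, le_rfl, h⟩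

theorem Runs.store {a : ℕ} {i e : RamExpr}
    (h : R { σ with arr :=
      Function.update σ.arr a (Function.update (σ.arr a) (i.eval σ) (e.eval σ)) }) :
    Runs (.store a i e) σ (i.cost + e.cost + 1) R :=
  ⟨_, _, Exec.store a i e σ, le_rfl, h⟩

theorem Runs.seq (h : Runs p σ T R') (h' : ∀ τ, R' τ → Runs q τ T' R) :
    Runs (.seq p q) σ (T + T' + 1) R := by
  obtain ⟨t, τ, h1, h2, h3⟩ := h
  obtain ⟨t', υ, h1', h2', h3'⟩ := h' τ h3
  exact ⟨_, υ, h1.seq h1', by omega, h3'⟩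

/-- A loop whose guard counts down from `n`. -/
theorem Runs.loop {e : RamExpr} {I : ℕ → RamState → Prop} {n : ℕ}
    (guard : ∀ i ≤ n, ∀ σ, I i σ → e.eval σ = n - i)
    (step : ∀ i < n, ∀ σ, I i σ → Runs p σ T (I (i + 1))) (h : I 0 σ) :
    Runs (.loop e p) σ (n * (T + e.cost + 1) + e.cost + 1) (I n) := by
  suffices H : ∀ d i σ, i + d = n → I i σ →
      Runs (.loop e p) σ (d * (T + e.cost + 1) + e.cost + 1) (I n) from H n 0 σ (by omega) h
  intro d
  induction d with
  | zero =>
    intro i σ hi hI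
    obtain rfl : i = n := by omega
    exact ⟨_, σ, Exec.loop_false (by rw [guard i le_rfl σ hI, Nat.sub_self]), by omega, hI⟩
  | succ d ih =>
    intro i σ hi hI
    obtain ⟨t, τ, h1, h2, h3⟩ := step i (by omega) σ hI
    obtain ⟨t', υ, h1', h2', h3'⟩ := ih (i + 1) τ (by omega) h3
    refine ⟨_, υ, Exec.loop_true (by rw [guard i (by omega) σ hI]; omega) h1 h1', ?_, h3'⟩
    rw [Nat.succ_mul]; omega

end

/-! ### Functions computable in polynomial time -/

/-- A way to read states of the machine as representations of elements of `α`: the first `size`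
variables and all arrays carry prescribed values. -/
structure Ctx (α : Type*) where
  size : ℕ
  var : α → ℕ → ℕ
  arr : α → ℕ → ℕ → ℕ

section

variable {α : Type*}

/-- The state `σ` represents `x`. -/
def Ctx.Models (C : Ctx α) (x : α) (σ : RamState) : Prop :=
  (∀ y < C.size, σ.var y = C.var x y) ∧ σ.arr = C.arr x

/-- The context with one more variable, which holds the second component of a pair. -/
def Ctx.ext (C : Ctx α) : Ctx (α × ℕ) where
  size := C.size + 1
  var p y := if y = C.size then p.2 else C.var p.1 y
  arr p := C.arr p.1

/-- The function `f` is computable in time polynomial in the values of the variables of the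
context, and its values are bounded by the same polynomial. For every `b` outside the context there
is a program that leaves the result in the variable `b` and changes no variable below `b`. -/
def Comp (C : Ctx α) (f : α → ℕ) : Prop :=
  ∀ b ≥ C.size, ∃ (prog : RamProg) (q : Polynomial ℕ), ∀ x σ N, C.Models x σ →
    (∀ y < C.size, σ.var y ≤ N) → f x ≤ q.eval N ∧
      Runs prog σ (q.eval N) fun τ =>
        τ.arr = σ.arr ∧ (∀ y < b, τ.var y = σ.var y) ∧ τ.var b = f x

variable {C : Ctx α} {f g : α → ℕ}

theorem Ctx.Models.of_eqOn {x : α} {σ τ : RamState} {b : ℕ} (h : C.Models x σ) (hb : C.size ≤ b)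
    (harr : τ.arr = σ.arr) (hvar : ∀ y < b, τ.var y = σ.var y) : C.Models x τ :=
  ⟨fun y hy => (hvar y (hy.trans_le hb)).trans (h.1 y hy), harr.trans h.2⟩

/-- A function that is given by an expression in the context. -/
theorem Comp.of_expr (e : RamExpr) (q : Polynomial ℕ)
    (h : ∀ x σ N, C.Models x σ → (∀ y < C.size, σ.var y ≤ N) →
      e.eval σ = f x ∧ f x ≤ q.eval N) : Comp C f := by
  refine fun b hb => ⟨.assign b e, q + Polynomial.C (e.cost + 1), fun x σ N hx hN => ?_⟩
  obtain ⟨h1, h2⟩ := h x σ N hx hN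
  simp only [Polynomial.eval_add, Polynomial.eval_C]
  refine ⟨by omega, Runs.mono (Runs.assign (R := fun τ => τ.arr = σ.arr ∧
    (∀ y < b, τ.var y = σ.var y) ∧ τ.var b = f x) ⟨rfl, fun y hy => ?_, ?_⟩) (by omega)
    fun _ => id⟩
  · exact RamState.var_set_ne hy.ne
  · rw [RamState.var_set_self]; exact h1

theorem Comp.lit (c : ℕ) : Comp C fun _ => c :=
  .of_expr (.lit c) (Polynomial.C c) fun x σ N _ _ => ⟨rfl, by simp⟩

theorem Comp.var {y : ℕ} (hy : y < C.size) : Comp C fun x => C.var x y :=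
  .of_expr (.var y) Polynomial.X fun x σ N hx hN => ⟨hx.1 y hy, by
    rw [Polynomial.eval_X, ← hx.1 y hy]; exact hN y hy⟩

/-- Composition with an operation that is given by an expression in two variables. -/
theorem Comp.binop (hf : Comp C f) (hg : Comp C g) (op : α → ℕ → ℕ → ℕ)
    (e : ℕ → ℕ → RamExpr) (c : ℕ) (hcost : ∀ y z, (e y z).cost ≤ c)
    (hop : ∀ x u v, op x u v ≤ u + v + 1)
    (heval : ∀ x σ y z, σ.arr = C.arr x → (e y z).eval σ = op x (σ.var y) (σ.var z)) :
    Comp C fun x => op x (f x) (g x) := by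
  intro b hb
  obtain ⟨p, q, hp⟩ := hf b hb
  obtain ⟨p', q', hp'⟩ := hg (b + 1) (by omega)
  refine ⟨.seq p (.seq p' (.assign b (e b (b + 1)))), q + q' + Polynomial.C (c + 3),
    fun x σ N hx hN => ?_⟩
  simp only [Polynomial.eval_add, Polynomial.eval_C]
  obtain ⟨h1, h2⟩ := hp x σ N hx hN
  obtain ⟨h1', -⟩ := hp' x σ N hx hN
  refine ⟨(hop x _ _).trans (by omega), ?_⟩
  have hc := hcost b (b + 1)
  refine Runs.mono (Runs.seq h2 fun τ hτ => Runs.seq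
    (hp' x τ N (hx.of_eqOn hb hτ.1 hτ.2.1) fun y hy => ?_).2 fun υ hυ => Runs.assign
      (R := fun υ => υ.arr = σ.arr ∧ (∀ y < b, υ.var y = σ.var y) ∧
        υ.var b = op x (f x) (g x)) ?_) (by omega) fun _ => id
  · rw [hτ.2.1 y (by omega)]; exact hN y hy
  · refine ⟨hυ.1.trans hτ.1, fun y hy => ?_, ?_⟩
    · rw [← hτ.2.1 y hy, ← hυ.2.1 y (by omega)]
      exact RamState.var_set_ne hy.ne
    · rw [RamState.var_set_self, heval x υ _ _ (hυ.1.trans (hτ.1.trans hx.2)), hυ.2.2,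
        hυ.2.1 b (by omega), hτ.2.2]

theorem Comp.add (hf : Comp C f) (hg : Comp C g) : Comp C fun x => f x + g x :=
  hf.binop hg (fun _ => (· + ·)) (fun y z => .add (.var y) (.var z)) 3 (fun _ _ => le_rfl)
    (fun _ _ _ => by omega) fun _ _ _ _ _ => rfl

theorem Comp.sub (hf : Comp C f) (hg : Comp C g) : Comp C fun x => f x - g x :=
  hf.binop hg (fun _ => (· - ·)) (fun y z => .sub (.var y) (.var z)) 3 (fun _ _ => le_rfl)
    (fun _ _ _ => by omega) fun _ _ _ _ _ => rfl

/-- Array entries can be tested for being nonzero. -/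
theorem Comp.get (hf : Comp C f) (a : ℕ) : Comp C fun x => 1 - (1 - C.arr x a (f x)) :=
  hf.binop hf (fun x u _ => 1 - (1 - C.arr x a u))
    (fun y _ => .sub (.lit 1) (.sub (.lit 1) (.get a (.var y)))) 6 (fun _ _ => le_rfl)
    (fun _ _ _ => by omega) fun x σ y z h => by simp [RamExpr.eval, h]

theorem Comp.ext (hf : Comp C f) : Comp C.ext fun p => f p.1 := by
  intro b hb
  obtain ⟨p, q, hp⟩ := hf b ((Nat.le_succ _).trans hb)
  refine ⟨p, q, fun x σ N hx hN => hp x.1 σ N ⟨fun y hy => ?_, hx.2⟩ fun y hy =>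
    hN y (Nat.lt_succ_of_lt hy)⟩
  rw [hx.1 y (Nat.lt_succ_of_lt hy)]
  exact if_neg hy.ne

theorem Comp.snd : Comp C.ext fun p => p.2 := by
  have := Comp.var (C := C.ext) (Nat.lt_succ_self C.size)
  simpa [Ctx.ext] using this

theorem Comp.sum {g : α → ℕ → ℕ} (hf : Comp C f) (hg : Comp C.ext fun p => g p.1 p.2) :
    Comp C fun x => ∑ i ∈ Finset.range (f x), g x i := by
  intro b hb
  obtain ⟨p, q, hp⟩ := hf (b + 1) (by omega)
  obtain ⟨p', q', hp'⟩ := hg (b + 5) (by simp only [Ctx.ext]; omega)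
  -- Variables: `b + 1` holds the bound, `b + 2` the partial sum, `b + 4` the counter. The value of
  -- the variable that the body uses for the summation index is saved in `b + 3`.
  let s := C.size
  let body : RamProg := .seq (.assign s (.var (b + 4))) (.seq p'
    (.seq (.assign (b + 2) (.add (.var (b + 2)) (.var (b + 5))))
      (.assign (b + 4) (.add (.var (b + 4)) (.lit 1)))))
  let q'' : Polynomial ℕ := q'.comp (Polynomial.X + q)
  refine ⟨.seq p (.seq (.assign (b + 2) (.lit 0)) (.seq (.assign (b + 3) (.var s))
    (.seq (.assign (b + 4) (.lit 0)) (.seq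
      (.loop (.sub (.var (b + 1)) (.var (b + 4))) body)
      (.seq (.assign s (.var (b + 3))) (.assign b (.var (b + 2)))))))),
    q + q * (q'' + 18) + 40, fun x σ N hx hN => ?_⟩
  obtain ⟨h1, h2⟩ := hp x σ N hx hN
  have hq'' : q''.eval N = q'.eval (N + q.eval N) := by simp [q'']
  have hmodel : ∀ i τ, i < f x → τ.arr = σ.arr → (∀ y < s, τ.var y = σ.var y) → τ.var s = i →
      C.ext.Models (x, i) τ ∧ ∀ y < C.ext.size, τ.var y ≤ N + q.eval N := by
    intro i τ hi harr hvar hs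
    refine ⟨⟨fun y hy => ?_, harr.trans hx.2⟩, fun y hy => ?_⟩
    · by_cases hys : y = s
      · subst hys; simp [hs, Ctx.ext, s]
      · have hy' : y < s := by simp only [Ctx.ext] at hy; omega
        rw [hvar y hy', hx.1 y hy']
        exact (if_neg hys).symm
    · by_cases hys : y = s
      · subst hys; omega
      · have hy' : y < s := by simp only [Ctx.ext] at hy; omega
        rw [hvar y hy']
        exact (hN y hy').trans (Nat.le_add_right _ _)
  let I : ℕ → RamState → Prop := fun i τ => τ.arr = σ.arr ∧
    (∀ y < b + 1, y ≠ s → τ.var y = σ.var y) ∧ τ.var (b + 1) = f x ∧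
    τ.var (b + 2) = ∑ j ∈ Finset.range i, g x j ∧ τ.var (b + 3) = σ.var s ∧ τ.var (b + 4) = i
  have hbody : ∀ i < f x, ∀ τ, I i τ → Runs body τ (q''.eval N + 13) (I (i + 1)) := by
    rintro i hi τ ⟨harr, hvar, hlim, hacc, hsave, hcnt⟩
    refine Runs.mono (Runs.seq (T' := q''.eval N + 10)
      (Runs.assign (R := fun υ => I i υ ∧ υ.var s = i) ?_) fun υ hυ => ?_)
      (by simp only [RamExpr.cost]; omega) fun _ => id
    · refine ⟨⟨harr, fun y hy hys => ?_, ?_, ?_, ?_, ?_⟩, ?_⟩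
      · exact (RamState.var_set_ne hys).trans (hvar y hy hys)
      all_goals simp only [RamExpr.eval]
      · rwa [RamState.var_set_ne (by omega)]
      · rwa [RamState.var_set_ne (by omega)]
      · rwa [RamState.var_set_ne (by omega)]
      · rwa [RamState.var_set_ne (by omega)]
      · rwa [RamState.var_set_self]
    obtain ⟨⟨harr, hvar, hlim, hacc, hsave, hcnt⟩, hs⟩ := hυ
    obtain ⟨hM, hB⟩ := hmodel i υ hi harr (fun y hy => hvar y (by omega) hy.ne) hs
    have := (hp' (x, i) υ _ hM hB).2
    rw [← hq''] at this
    refine Runs.mono (this.seq (T' := 9) fun ω hω => Runs.mono (Runs.seq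
      (Runs.assign (R := fun ω' => ω' = ω.set (b + 2)
        (∑ j ∈ Finset.range (i + 1), g x j)) ?_)
      fun ω' hω' => Runs.assign (R := I (i + 1)) ?_) le_rfl fun _ => id) (by omega) fun _ => id
    · simp only [RamExpr.eval, Finset.sum_range_succ, hω.2.2, hω.2.1 (b + 2) (by omega), hacc]
    · subst hω'
      obtain ⟨warr, wvar, -⟩ := hω
      refine ⟨warr.trans harr, fun y hy hys => ?_, ?_, ?_, ?_, ?_⟩
      · rw [RamState.var_set_ne (by omega), RamState.var_set_ne (by omega),
          wvar y (by omega), hvar y hy hys]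
      · rw [RamState.var_set_ne (by omega), RamState.var_set_ne (by omega),
          wvar _ (by omega), hlim]
      · rw [RamState.var_set_ne (by omega), RamState.var_set_self]
      · rw [RamState.var_set_ne (by omega), RamState.var_set_ne (by omega),
          wvar _ (by omega), hsave]
      · simp only [RamExpr.eval]
        rw [RamState.var_set_self, RamState.var_set_ne (by omega), wvar _ (by omega), hcnt]
  have hmul : f x * (q''.eval N + 18) ≤ q.eval N * (q''.eval N + 18) := Nat.mul_le_mul_right _ h1
  have heval : (q + q * (q'' + 18) + 40).eval N =
      q.eval N + q.eval N * (q''.eval N + 18) + 40 := by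
    simp [Polynomial.eval_add, Polynomial.eval_mul]
  rw [heval]
  beta_reduce
  constructor
  · have : ∑ i ∈ Finset.range (f x), g x i ≤ f x * (q''.eval N + 18) := by
      refine (Finset.sum_le_card_nsmul _ _ (q''.eval N + 18) fun i hi => ?_).trans (by simp)
      -- The bound on the body holds in a state that carries the summation index.
      obtain ⟨hM, hB⟩ := hmodel i (σ.set s i)
        (Finset.mem_range.1 hi) rfl (fun y hy => RamState.var_set_ne hy.ne)
        (RamState.var_set_self ..)
      have := (hp' (x, i) _ _ hM hB).1
      rw [← hq''] at this
      exact this.trans (Nat.le_add_right _ _)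
    omega
  · refine Runs.mono (Runs.seq h2 fun τ hτ => Runs.seq (Runs.assign
      (R := fun υ => υ = τ.set (b + 2) 0) rfl) fun υ hυ =>
      Runs.seq (Runs.assign
      (R := fun ω => ω = υ.set (b + 3) (σ.var s)) ?_)
      fun ω hω => Runs.seq (Runs.assign (R := I 0) ?_) fun υ' hυ' => Runs.seq
      (Runs.loop (I := I) ?_ hbody hυ') fun ω' hω' => Runs.seq (Runs.assign
      (R := fun υ => υ = ω'.set s (σ.var s)) ?_)
      fun ω'' hω'' => Runs.assign (R := fun τ => τ.arr = σ.arr ∧ (∀ y < b, τ.var y = σ.var y) ∧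
        τ.var b = ∑ i ∈ Finset.range (f x), g x i) ?_)
      ?_ fun _ => id
    · subst hυ
      simp only [RamExpr.eval, RamState.var_set_ne (show s ≠ b + 2 by omega),
        hτ.2.1 s (by omega)]
    · subst hω hυ
      obtain ⟨harr, hvar, hlim⟩ := hτ
      refine ⟨harr, fun y hy _ => ?_, ?_, ?_, ?_, ?_⟩
      · rw [RamState.var_set_ne (by omega), RamState.var_set_ne (by omega),
          RamState.var_set_ne (by omega), hvar y hy]
      · rw [RamState.var_set_ne (by omega), RamState.var_set_ne (by omega),
          RamState.var_set_ne (by omega), hlim]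
      · rw [RamState.var_set_ne (by omega), RamState.var_set_ne (by omega),
          RamState.var_set_self, Finset.sum_range_zero]
      · rw [RamState.var_set_ne (by omega), RamState.var_set_self]
      · rw [RamState.var_set_self]; rfl
    · rintro i - τ ⟨-, -, hlim, -, -, hcnt⟩
      simp only [RamExpr.eval, hlim, hcnt]
    · simp only [RamExpr.eval, hω'.2.2.2.2.1]
    · subst hω''
      obtain ⟨harr, hvar, -, hacc, -, -⟩ := hω'
      refine ⟨harr, fun y hy => ?_, ?_⟩
      · rw [RamState.var_set_ne hy.ne]
        by_cases hys : y = s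
        · subst hys; exact RamState.var_set_self ..
        · rw [RamState.var_set_ne hys, hvar y (by omega) hys]
      · simp only [RamExpr.eval]
        rw [RamState.var_set_self, RamState.var_set_ne (by omega), hacc]
    · simp only [RamExpr.cost]
      have : f x * (q''.eval N + 13 + (1 + 1 + 1) + 1) ≤ f x * (q''.eval N + 18) :=
        Nat.mul_le_mul_left _ (by omega)
      omega

theorem Comp.mul (hf : Comp C f) (hg : Comp C g) : Comp C fun x => f x * g x := by
  simpa using hf.sum (g := fun x _ => g x) hg.ext

theorem Comp.pow (hf : Comp C f) (j : ℕ) : Comp C fun x => f x ^ j := by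
  induction j with
  | zero => simpa using Comp.lit 1
  | succ j ih => simpa only [pow_succ] using ih.mul hf

theorem sum_range_sub_eq_div (a : ℕ) {b : ℕ} (hb : 0 < b) :
    ∑ i ∈ Finset.range a, (1 - ((i + 1) * b - a)) = a / b := by
  have h : ∀ i, 1 - ((i + 1) * b - a) = if i < a / b then 1 else 0 := by
    intro i
    have := Nat.le_div_iff_mul_le (x := i + 1) (y := a) hb
    split_ifs with h <;> omega
  simp only [h, Finset.sum_boole, Nat.cast_id]
  rw [show (Finset.range a).filter (· < a / b) = Finset.range (a / b) from ?_, Finset.card_range]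
  ext i
  simp only [Finset.mem_filter, Finset.mem_range, and_iff_right_iff_imp]
  exact fun hi => hi.trans_le (Nat.div_le_self a b)

theorem Comp.div (hf : Comp C f) (hg : Comp C g) : Comp C fun x => f x / g x := by
  have := ((Comp.lit 1).sub ((Comp.lit 1).sub hg)).mul (hf.sum
    (g := fun x i => 1 - ((i + 1) * g x - f x))
    ((Comp.lit 1).sub ((((Comp.snd.add (.lit 1)).mul hg.ext).sub hf.ext))))
  refine (funext fun x => ?_ : (fun x => f x / g x) = _) ▸ this
  rcases Nat.eq_zero_or_pos (g x) with h | h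
  · simp [h]
  · rw [sum_range_sub_eq_div _ h, show 1 - (1 - g x) = 1 by omega, one_mul]

theorem Comp.mod (hf : Comp C f) (hg : Comp C g) : Comp C fun x => f x % g x := by
  simpa only [Nat.mod_eq_sub_mul_div] using hf.sub (hg.mul (hf.div hg))

theorem Comp.finset_sum {ι : Type*} (s : Finset ι) {F : ι → α → ℕ} (hF : ∀ i, Comp C (F i)) :
    Comp C fun x => ∑ i ∈ s, F i x := by
  classical
  induction s using Finset.induction_on with
  | empty => simpa using Comp.lit 0
  | insert i s hi ih => simpa only [Finset.sum_insert hi] using (hF i).add ih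

/-! ### Properties decidable in polynomial time -/

open Classical in
/-- The property `P` is decidable in polynomial time. -/
def DecPoly (C : Ctx α) (P : α → Prop) : Prop := Comp C fun x => if P x then 1 else 0

variable {P Q : α → Prop}

open Classical in
theorem DecPoly.of_comp (hf : Comp C f) (h : ∀ x, f x = if P x then 1 else 0) : DecPoly C P := by
  simpa only [DecPoly, ← h] using hf

theorem DecPoly.not (hP : DecPoly C P) : DecPoly C fun x => ¬ P x := by
  classical
  exact .of_comp ((Comp.lit 1).sub hP) fun x => by by_cases h : P x <;> simp [h]

theorem DecPoly.and (hP : DecPoly C P) (hQ : DecPoly C Q) : DecPoly C fun x => P x ∧ Q x := by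
  classical
  exact .of_comp (Comp.mul hP hQ) fun x => by
    by_cases h : P x <;> by_cases h' : Q x <;> simp [h, h']

theorem DecPoly.or (hP : DecPoly C P) (hQ : DecPoly C Q) : DecPoly C fun x => P x ∨ Q x := by
  simpa only [not_and_or, not_not] using (hP.not.and hQ.not).not

theorem DecPoly.imp (hP : DecPoly C P) (hQ : DecPoly C Q) : DecPoly C fun x => P x → Q x := by
  simpa only [imp_iff_not_or] using hP.not.or hQ

theorem DecPoly.iff (hP : DecPoly C P) (hQ : DecPoly C Q) : DecPoly C fun x => P x ↔ Q x := by
  simpa only [iff_def] using (hP.imp hQ).and (hQ.imp hP)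

theorem DecPoly.const (p : Prop) : DecPoly C fun _ => p :=
  Comp.lit _

theorem DecPoly.le (hf : Comp C f) (hg : Comp C g) : DecPoly C fun x => f x ≤ g x := by
  refine .of_comp ((Comp.lit 1).sub (hf.sub hg)) fun x => ?_
  split_ifs <;> omega

theorem DecPoly.eq (hf : Comp C f) (hg : Comp C g) : DecPoly C fun x => f x = g x := by
  simpa only [le_antisymm_iff] using (DecPoly.le hf hg).and (DecPoly.le hg hf)

theorem DecPoly.lt (hf : Comp C f) (hg : Comp C g) : DecPoly C fun x => f x < g x :=
  DecPoly.le (hf.add (.lit 1)) hg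

theorem DecPoly.get (hf : Comp C f) (a : ℕ) : DecPoly C fun x => C.arr x a (f x) ≠ 0 := by
  refine .of_comp (hf.get a) fun x => ?_
  split_ifs <;> omega

open Classical in
/-- The instances of a property below a bound can be counted. -/
theorem DecPoly.count {P : α → ℕ → Prop} (hf : Comp C f) (hP : DecPoly C.ext fun p => P p.1 p.2) :
    Comp C fun x => ((Finset.range (f x)).filter (P x)).card := by
  simpa only [Finset.card_filter] using
    hf.sum (g := fun x i => if P x i then 1 else 0) hP

theorem DecPoly.bexists {P : α → ℕ → Prop} (hf : Comp C f)
    (hP : DecPoly C.ext fun p => P p.1 p.2) : DecPoly C fun x => ∃ i < f x, P x i := by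
  classical
  have := DecPoly.lt (.lit 0) (DecPoly.count hf hP)
  simpa only [Finset.card_pos, Finset.filter_nonempty_iff, Finset.mem_range] using this

theorem DecPoly.ball {P : α → ℕ → Prop} (hf : Comp C f)
    (hP : DecPoly C.ext fun p => P p.1 p.2) : DecPoly C fun x => ∀ i < f x, P x i := by
  have := (DecPoly.bexists hf (P := fun x i => ¬ P x i) hP.not).not
  simpa only [not_exists, not_and, not_not] using this

theorem DecPoly.forall {ι : Type*} [Finite ι] {P : ι → α → Prop} (hP : ∀ i, DecPoly C (P i)) :
    DecPoly C fun x => ∀ i, P i x := by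
  classical
  have := Fintype.ofFinite ι
  have : ∀ s : Finset ι, DecPoly C fun x => ∀ i ∈ s, P i x := by
    intro s
    induction s using Finset.induction_on with
    | empty => simpa using DecPoly.const True
    | insert i s hi ih => simpa only [Finset.forall_mem_insert] using (hP i).and ih
  simpa using this Finset.univ

end

/-! ### Filling arrays -/

/-- The context of a program that gets two numbers and some arrays. -/
def baseCtx : Ctx (ℕ × ℕ × (ℕ → ℕ → ℕ)) where
  size := 2
  var x y := if y = 0 then x.1 else x.2.1
  arr x := x.2.2

theorem Comp.base_fst : Comp baseCtx fun x => x.1 :=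
  Comp.var (C := baseCtx) (y := 0) (by decide)

theorem Comp.base_snd : Comp baseCtx fun x => x.2.1 :=
  Comp.var (C := baseCtx) (y := 1) (by decide)

open Classical in
/-- Courses-of-values recursion: the characteristic function of `W` can be stored in the array `a`,
up to a bound, if each of its values can be decided from the previous ones. -/
theorem exists_fill (a : ℕ) {f : ℕ → ℕ → ℕ} (hf : Comp baseCtx fun x => f x.1 x.2.1)
    {P : (ℕ × ℕ × (ℕ → ℕ → ℕ)) × ℕ → Prop} (hP : DecPoly baseCtx.ext P) :
    ∃ (prog : RamProg) (q : Polynomial ℕ), ∀ (m n : ℕ) (σ : RamState) (W : ℕ → Prop),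
      σ.var 0 = m → σ.var 1 = n →
      (∀ c < f m n, ∀ arr : ℕ → ℕ → ℕ, (∀ a' ≠ a, arr a' = σ.arr a') →
        (∀ c' < c, arr a c' = if W c' then 1 else 0) → (P ((m, n, arr), c) ↔ W c)) →
      Runs prog σ (q.eval (m + n)) fun τ => τ.var 0 = m ∧ τ.var 1 = n ∧
        (∀ a' ≠ a, τ.arr a' = σ.arr a') ∧ ∀ c < f m n, τ.arr a c = if W c then 1 else 0 := by
  obtain ⟨p, q, hp⟩ := hf 3 (by decide)
  obtain ⟨p', q', hp'⟩ := hP 4 (by decide)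
  let body : RamProg := .seq p' (.seq (.store a (.var 2) (.var 4))
    (.assign 2 (.add (.var 2) (.lit 1))))
  let q'' : Polynomial ℕ := q'.comp (Polynomial.X + q)
  refine ⟨.seq p (.seq (.assign 2 (.lit 0)) (.loop (.sub (.var 3) (.var 2)) body)),
    q + q * (q'' + 20) + 20, fun m n σ W h0 h1 hW => ?_⟩
  have hq'' : q''.eval (m + n) = q'.eval (m + n + q.eval (m + n)) := by simp [q'']
  obtain ⟨hle, hrun⟩ := hp (m, n, σ.arr) σ (m + n)
    ⟨fun y hy => by
      obtain rfl | rfl : y = 0 ∨ y = 1 := by simp only [baseCtx] at hy; omega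
      · exact h0
      · exact h1, rfl⟩
    (fun y hy => by
      obtain rfl | rfl : y = 0 ∨ y = 1 := by simp only [baseCtx] at hy; omega
      all_goals omega)
  dsimp only at hle hrun
  let I : ℕ → RamState → Prop := fun i τ => τ.var 0 = m ∧ τ.var 1 = n ∧ τ.var 2 = i ∧
    τ.var 3 = f m n ∧ (∀ a' ≠ a, τ.arr a' = σ.arr a') ∧
    ∀ c < i, τ.arr a c = if W c then 1 else 0
  have hbody : ∀ i < f m n, ∀ τ, I i τ → Runs body τ (q''.eval (m + n) + 9) (I (i + 1)) := by
    rintro i hi τ ⟨g0, g1, g2, g3, harr, hval⟩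
    have hrun' := (hp' ((m, n, τ.arr), i) τ (m + n + q.eval (m + n))
      ⟨fun y hy => by
        obtain rfl | rfl | rfl : y = 0 ∨ y = 1 ∨ y = 2 := by
          simp only [Ctx.ext, baseCtx] at hy; omega
        · exact g0
        · exact g1
        · exact g2, rfl⟩
      (fun y hy => by
        obtain rfl | rfl | rfl : y = 0 ∨ y = 1 ∨ y = 2 := by
          simp only [Ctx.ext, baseCtx] at hy; omega
        all_goals omega)).2
    rw [← hq''] at hrun'
    refine Runs.mono (hrun'.seq fun υ hυ => Runs.seq (Runs.store (R := fun ω =>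
      ω = { υ with arr := Function.update τ.arr a (Function.update (τ.arr a) i
        (if W i then 1 else 0)) }) ?_) fun ω hω => Runs.assign (R := I (i + 1)) ?_)
      (by simp only [RamExpr.cost]; omega) fun _ => id
    · simp only [RamExpr.eval, hυ.1, hυ.2.1 2 (by omega), g2, hυ.2.2]
      have := hW i hi τ.arr harr hval
      simp only [this]
    · subst hω
      obtain ⟨-, hvar, -⟩ := hυ
      refine ⟨?_, ?_, ?_, ?_, fun a' ha' => ?_, fun c hc => ?_⟩
      · rw [RamState.var_set_ne (by omega)]; exact (hvar 0 (by omega)).trans g0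
      · rw [RamState.var_set_ne (by omega)]; exact (hvar 1 (by omega)).trans g1
      · rw [RamState.var_set_self]
        simp only [RamExpr.eval, hvar 2 (by omega), g2]
      · rw [RamState.var_set_ne (by omega)]; exact (hvar 3 (by omega)).trans g3
      · dsimp only [RamState.set]
        rw [Function.update_of_ne ha', harr a' ha']
      · dsimp only [RamState.set]
        rw [Function.update_self]
        by_cases hci : c = i
        · subst hci; rw [Function.update_self]
        · rw [Function.update_of_ne hci]
          exact hval c (by omega)
  have hmul : f m n * (q''.eval (m + n) + 20) ≤ q.eval (m + n) * (q''.eval (m + n) + 20) :=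
    Nat.mul_le_mul_right _ hle
  have heval : (q + q * (q'' + 20) + 20).eval (m + n) =
      q.eval (m + n) + q.eval (m + n) * (q''.eval (m + n) + 20) + 20 := by
    simp [Polynomial.eval_add, Polynomial.eval_mul]
  rw [heval]
  refine Runs.mono (hrun.seq fun τ hτ => Runs.seq (Runs.assign (R := I 0) ?_) fun υ hυ =>
    Runs.loop (I := I) ?_ hbody hυ) ?_ fun τ hτ => ⟨hτ.1, hτ.2.1, hτ.2.2.2.2.1, hτ.2.2.2.2.2⟩
  · obtain ⟨harr, hvar, hlim⟩ := hτ
    refine ⟨?_, ?_, ?_, ?_, fun a' _ => by rw [← harr]; rfl,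
      fun c hc => absurd hc (Nat.not_lt_zero c)⟩
    · rw [RamState.var_set_ne (by omega), hvar 0 (by omega), h0]
    · rw [RamState.var_set_ne (by omega), hvar 1 (by omega), h1]
    · rw [RamState.var_set_self]; rfl
    · rw [RamState.var_set_ne (by omega), hlim]
  · rintro i - τ ⟨-, -, hcnt, hlim, -⟩
    simp only [RamExpr.eval, hlim, hcnt]
  · simp only [RamExpr.cost]
    have : f m n * (q''.eval (m + n) + 9 + (1 + 1 + 1) + 1) ≤ f m n * (q''.eval (m + n) + 20) :=
      Nat.mul_le_mul_left _ (by omega)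
    omega

/-! ### Refining a relation between tuples -/

section

variable {A : Type w} {B : Type w'} {k : ℕ}

/-- The degree condition that decides whether a difunctional relation `E`, i.e. a disjoint union of
complete bipartite graphs, contains the graph of a bijection. -/
def DegreeCond (E : A → B → Prop) : Prop :=
  (∀ a, ∃ b, E a b) ∧ (∀ b, ∃ a, E a b) ∧
    ∀ a b, E a b → Nat.card {b' // E a b'} = Nat.card {a' // E a' b}

theorem exists_equiv_iff_degreeCond [Finite A] [Finite B] {E : A → B → Prop}
    (hE : ∀ a a' b b', E a b → E a' b → E a' b' → E a b') :
    (∃ f : A ≃ B, ∀ a, E a (f a)) ↔ DegreeCond E := by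
  constructor
  · rintro ⟨f, hf⟩
    refine ⟨fun a => ⟨_, hf a⟩, fun b => ⟨f.symm b, by simpa using hf (f.symm b)⟩,
      fun a b hab => (Nat.card_congr
        (Equiv.subtypeEquiv f fun a' => ⟨fun h => ?_, fun h => ?_⟩)).symm⟩
    · exact hE _ _ _ _ hab h (hf a')
    · exact hE _ _ _ _ (hf a') h hab
  · rintro ⟨h1, h2, h3⟩
    -- The colour of a vertex is the right-hand side of its component.
    let d : B → Set B := fun b => {b' | ∃ a, E a b ∧ E a b'}
    have hd : ∀ a b, d b = {b' | E a b'} ↔ E a b := by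
      intro a b
      constructor
      · intro h
        obtain ⟨a', ha'⟩ := h2 b
        have : b ∈ d b := ⟨a', ha', ha'⟩
        rwa [h] at this
      · intro h
        ext b'
        exact ⟨fun ⟨a', h', h''⟩ => hE _ _ _ _ h h' h'', fun h' => ⟨a, h, h'⟩⟩
    obtain ⟨f, hf⟩ := exists_equiv_of_card_fiber_eq (c := fun a => {b | E a b}) (d := d) (by
      intro q
      by_cases hq : ∃ a, {b | E a b} = q
      · obtain ⟨a, rfl⟩ := hq
        obtain ⟨b, hab⟩ := h1 a
        simp only [hd]
        rw [h3 a b hab]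
        refine Nat.card_congr (Equiv.subtypeEquivRight fun a' => ?_)
        rw [← (hd a b).2 hab, eq_comm, hd]
      · push Not at hq
        have : IsEmpty {a : A // {b | E a b} = q} := ⟨fun a => hq _ a.2⟩
        have : IsEmpty {b : B // d b = q} := ⟨fun b => by
          obtain ⟨a, ha⟩ := h2 b
          exact hq a (((hd a _).2 ha).symm.trans b.2)⟩
        rw [Nat.card_of_isEmpty, Nat.card_of_isEmpty])
    exact ⟨f, fun a => (hd _ _).1 (hf a)⟩

/-- The pairs of `k`-tuples from which Duplicator can answer `i` moves of pebbles. -/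
def tupleIter (L : FirstOrder.Language.{u, v}) {A : Type w} {B : Type w'} [L.Structure A]
    [L.Structure B] {k : ℕ} : ℕ → (Fin k → A) → (Fin k → B) → Prop
  | 0, x, y => atp L x = atp L y
  | i + 1, x, y => tupleIter L i x y ∧ ∀ j, ∃ f : A ≃ B, ∀ a,
      tupleIter L i (Function.update x j a) (Function.update y j (f a))

variable {L : FirstOrder.Language.{u, v}} [L.Structure A] [L.Structure B]

theorem tupleIter_difunctional (i : ℕ) (x x' : Fin k → A) (y y' : Fin k → B)
    (h1 : tupleIter L i x y) (h2 : tupleIter L i x' y) (h3 : tupleIter L i x' y') :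
    tupleIter L i x y' := by
  induction i generalizing x x' y y' with
  | zero => exact Eq.trans h1 (Eq.trans (Eq.symm h2) h3)
  | succ i ih =>
    refine ⟨ih _ _ _ _ h1.1 h2.1 h3.1, fun j => ?_⟩
    obtain ⟨f1, hf1⟩ := h1.2 j
    obtain ⟨f2, hf2⟩ := h2.2 j
    obtain ⟨f3, hf3⟩ := h3.2 j
    refine ⟨(f1.trans f2.symm).trans f3, fun a => ih _ _ _ _ (hf1 a) ?_ (hf3 _)⟩
    simpa using hf2 (f2.symm (f1 a))

theorem tupleIter_succ_iff [Finite A] [Finite B] {i : ℕ} {x : Fin k → A} {y : Fin k → B} :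
    tupleIter L (i + 1) x y ↔ tupleIter L i x y ∧ ∀ j, DegreeCond fun a b =>
      tupleIter L i (Function.update x j a) (Function.update y j b) :=
  and_congr_right' (forall_congr' fun j => exists_equiv_iff_degreeCond
    (E := fun a b => tupleIter L i (Function.update x j a) (Function.update y j b))
    fun _ _ _ _ => tupleIter_difunctional i _ _ _ _)

theorem tupleIter.atp_eq {i : ℕ} {x : Fin k → A} {y : Fin k → B} (h : tupleIter L i x y) :
    atp L x = atp L y := by
  induction i with
  | zero => exact h
  | succ i ih => exact ih h.1

variable [Fintype A] [Fintype B]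

theorem exists_tupleIter_stable :
    ∃ N ≤ Fintype.card A ^ k * Fintype.card B ^ k, ∀ i ≥ N, ∀ (x : Fin k → A) (y : Fin k → B),
      tupleIter L i x y ↔ tupleIter L N x y := by
  let U : ℕ → Set ((Fin k → A) × (Fin k → B)) := fun i => {q | tupleIter L i q.1 q.2}
  obtain ⟨N, hN, h⟩ := exists_stable U (fun i q hq => hq.1) (fun i hi => by
    have h : ∀ x y, tupleIter L (i + 1) x y ↔ tupleIter L i x y := fun x y =>
      Set.ext_iff.1 hi (x, y)
    ext ⟨x, y⟩
    change (_ ∧ _) ↔ (_ ∧ _)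
    simp only [h])
  refine ⟨N, hN.trans (by simp), fun i hi x y => Set.ext_iff.1 (h i hi) (x, y)⟩

theorem tupleIter_iff_covered [DecidableEq A] {i : ℕ}
    (hi : Fintype.card A ^ k * Fintype.card B ^ k ≤ i) {x : Fin k → A} {y : Fin k → B} :
    tupleIter L i x y ↔ Covered (cofp L A B k) (zipPairs x y) := by
  constructor
  · obtain ⟨N, hN, h⟩ := exists_tupleIter_stable (A := A) (B := B) (k := k) (L := L)
    refine covered_cofp_of_tuples (Q := tupleIter L i) (fun x y hxy => hxy.atp_eq)
      fun x y hxy j => ?_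
    rw [h i (hN.trans hi), ← h (i + 1) ((hN.trans hi).trans (Nat.le_succ i))] at hxy
    exact hxy.2 j
  · clear hi
    intro h
    have hS := isStrategy_cofp (A := A) (B := B) (k := k) L
    induction i generalizing x y with
    | zero => exact isPairIso_zipPairs_iff.1 (hS.isPairIso h)
    | succ i ih =>
      refine ⟨ih h, fun j => ?_⟩
      obtain ⟨f, hf⟩ := hS.replace_tuple h j
      exact ⟨f, fun a => ih (hf a)⟩

omit [Fintype A] [Fintype B] [L.Structure A] [L.Structure B] in
theorem hasGraph_iff_covered {S : Family A B k} (hS : IsPresheaf S) {l : ℕ} {x : Fin l → A}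
    {y : Fin l → B} : HasGraph S x y ↔ Covered S (zipPairs x y) := by
  classical
  constructor
  · rintro ⟨C, s, hs, h⟩
    refine ⟨C, s, hs, ?_⟩
    rintro _ ⟨i, rfl⟩
    exact (h _ _).2 ⟨i, rfl, rfl⟩
  · rintro ⟨C, s, hs, h⟩
    have hsub : C.1.filter (fun a => ∃ i, x i = a) ⊆ C.1 := Finset.filter_subset _ _
    refine ⟨⟨_, (Finset.card_le_card hsub).trans C.2⟩, _, hS _ C hsub s hs, fun a b => ⟨?_, ?_⟩⟩
    · rintro ⟨ha, hab⟩
      obtain ⟨i, rfl⟩ := (Finset.mem_filter.1 ha).2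
      obtain ⟨_, hi⟩ := h _ ⟨i, rfl⟩
      exact ⟨i, rfl, hi.symm.trans hab⟩
    · rintro ⟨i, rfl, rfl⟩
      obtain ⟨hx, hi⟩ := h _ ⟨i, rfl⟩
      exact ⟨Finset.mem_filter.2 ⟨hx, i, rfl⟩, hi⟩

/-- A nonempty fixpoint has a section listed by `k`-tuples, unless there are no `k`-tuples; then
only the relations without arguments matter. -/
theorem cofp_ne_bot_iff_tuples [DecidableEq A] :
    cofp L A B k ≠ ⊥ ↔
      (∃ (x : Fin k → A) (y : Fin k → B), Covered (cofp L A B k) (zipPairs x y)) ∨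
      (k ≠ 0 ∧ Fintype.card A = 0 ∧ Fintype.card B = 0 ∧ ∀ R : L.Relations 0,
        (RelMap R (Fin.elim0 : Fin 0 → A) ↔ RelMap R (Fin.elim0 : Fin 0 → B))) := by
  constructor
  · intro h
    have hS := isStrategy_cofp (A := A) (B := B) (k := k) L
    have h0 := covered_empty_iff.2 h
    by_cases hne : Nonempty (Fin k → A)
    · obtain ⟨F, hF⟩ := hS.exists_equiv_tuples h0 k le_rfl
      obtain ⟨x⟩ := hne
      exact Or.inl ⟨x, F x, hF x⟩
    · have hk : k ≠ 0 := by
        rintro rfl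
        exact hne ⟨Fin.elim0⟩
      have hA : Fintype.card A = 0 := Fintype.card_eq_zero_iff.2 ⟨fun a => hne ⟨fun _ => a⟩⟩
      obtain ⟨f, -⟩ := hS.extend h0 (by simpa using Nat.pos_of_ne_zero hk)
      refine Or.inr ⟨hk, hA, (Fintype.card_congr f).symm.trans hA, fun R => ?_⟩
      have := (hS.isPairIso h0).2 0 R Fin.elim0 fun i => i.elim0
      convert this
  · rintro (⟨x, y, h⟩ | ⟨-, hA, hB, hR⟩)
    · exact h.ne_bot
    · have hA := Fintype.card_eq_zero_iff.1 hA
      have hB := Fintype.card_eq_zero_iff.1 hB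
      refine (covered_cofp_of_placements (L := L) (Q := fun _ => True) (fun p _ => ⟨?_, ?_⟩)
        (fun _ _ _ => ⟨Equiv.equivOfIsEmpty A B, fun a => hA.elim a⟩)
        (p := fun _ => none) trivial).ne_bot
      · exact fun x => hA.elim x.1
      · intro n R x _
        obtain rfl | hn := Nat.eq_zero_or_pos n
        · have := hR R
          convert this
        · exact hA.elim (x ⟨0, hn⟩).1

end

/-! ### Codes of pairs of tuples -/

section

variable {k m n : ℕ}

/-- The code of a pair of tuples, which is also its position in the output array. -/
def pairCode (x : Fin k → Fin m) (y : Fin k → Fin n) : ℕ :=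
  ∑ i : Fin k, (x i : ℕ) * m ^ (i : ℕ) + m ^ k * ∑ i : Fin k, (y i : ℕ) * n ^ (i : ℕ)

/-- The `j`-th entry of the first tuple of the pair with code `c`. -/
def leftDigit (k m j c : ℕ) : ℕ := c % m ^ k / m ^ j % m

/-- The `j`-th entry of the second tuple of the pair with code `c`. -/
def rightDigit (k m n j c : ℕ) : ℕ := c / m ^ k / n ^ j % n

/-- The code that arises from `c` if the `j`-th entries are replaced by `a` and `b`. -/
def recode (k m n j c a b : ℕ) : ℕ :=
  (c % m ^ k - leftDigit k m j c * m ^ j + a * m ^ j) +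
    m ^ k * (c / m ^ k - rightDigit k m n j c * n ^ j + b * n ^ j)

theorem sum_digits_lt (x : Fin k → Fin m) : ∑ i : Fin k, (x i : ℕ) * m ^ (i : ℕ) < m ^ k :=
  (finFunctionFinEquiv x).2

theorem sum_digits_injective {x x' : Fin k → Fin m}
    (h : ∑ i : Fin k, (x i : ℕ) * m ^ (i : ℕ) = ∑ i : Fin k, (x' i : ℕ) * m ^ (i : ℕ)) :
    x = x' :=
  finFunctionFinEquiv.injective (Fin.ext h)

theorem sum_digits_div_mod (x : Fin k → Fin m) (j : Fin k) :
    (∑ i : Fin k, (x i : ℕ) * m ^ (i : ℕ)) / m ^ (j : ℕ) % m = x j :=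
  congrArg Fin.val (congrFun (finFunctionFinEquiv.symm_apply_apply x) j)

theorem exists_sum_digits {c : ℕ} (hc : c < m ^ k) :
    ∃ x : Fin k → Fin m, ∑ i : Fin k, (x i : ℕ) * m ^ (i : ℕ) = c :=
  ⟨finFunctionFinEquiv.symm ⟨c, hc⟩,
    congrArg Fin.val (finFunctionFinEquiv.apply_symm_apply ⟨c, hc⟩)⟩

theorem sum_digits_update (x : Fin k → Fin m) (j : Fin k) (a : Fin m) :
    ∑ i : Fin k, (Function.update x j a i : ℕ) * m ^ (i : ℕ) =
      ∑ i : Fin k, (x i : ℕ) * m ^ (i : ℕ) - x j * m ^ (j : ℕ) + a * m ^ (j : ℕ) := by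
  rw [← Finset.add_sum_erase _ _ (Finset.mem_univ j),
    ← Finset.add_sum_erase _ (fun i => (x i : ℕ) * m ^ (i : ℕ)) (Finset.mem_univ j)]
  have : ∑ i ∈ Finset.univ.erase j, (Function.update x j a i : ℕ) * m ^ (i : ℕ) =
      ∑ i ∈ Finset.univ.erase j, (x i : ℕ) * m ^ (i : ℕ) :=
    Finset.sum_congr rfl fun i hi => by
      rw [Function.update_of_ne (Finset.ne_of_mem_erase hi)]
  rw [this, Function.update_self]
  omega

variable (x : Fin k → Fin m) (y : Fin k → Fin n)

theorem pairCode_mod : pairCode x y % m ^ k = ∑ i : Fin k, (x i : ℕ) * m ^ (i : ℕ) := by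
  rw [pairCode, Nat.add_mul_mod_self_left, Nat.mod_eq_of_lt (sum_digits_lt x)]

theorem pairCode_div : pairCode x y / m ^ k = ∑ i : Fin k, (y i : ℕ) * n ^ (i : ℕ) := by
  have := sum_digits_lt x
  rw [pairCode, Nat.add_mul_div_left _ _ (by omega), Nat.div_eq_of_lt this, zero_add]

theorem pairCode_lt : pairCode x y < m ^ k * n ^ k := by
  have h1 := sum_digits_lt x
  have h2 := sum_digits_lt y
  calc pairCode x y < m ^ k + m ^ k * ∑ i : Fin k, (y i : ℕ) * n ^ (i : ℕ) :=
        Nat.add_lt_add_right h1 _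
    _ = m ^ k * (∑ i : Fin k, (y i : ℕ) * n ^ (i : ℕ) + 1) := by ring
    _ ≤ m ^ k * n ^ k := Nat.mul_le_mul_left _ h2

theorem leftDigit_pairCode (j : Fin k) : leftDigit k m j (pairCode x y) = x j := by
  rw [leftDigit, pairCode_mod, sum_digits_div_mod]

theorem rightDigit_pairCode (j : Fin k) : rightDigit k m n j (pairCode x y) = y j := by
  rw [rightDigit, pairCode_div, sum_digits_div_mod]

theorem recode_pairCode (j : Fin k) (a : Fin m) (b : Fin n) :
    recode k m n j (pairCode x y) a b =
      pairCode (Function.update x j a) (Function.update y j b) := by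
  rw [recode, leftDigit_pairCode, rightDigit_pairCode, pairCode_mod, pairCode_div,
    ← sum_digits_update, ← sum_digits_update, pairCode]

variable {x y} in
theorem pairCode_injective {x' : Fin k → Fin m} {y' : Fin k → Fin n}
    (h : pairCode x y = pairCode x' y') : x = x' ∧ y = y' := by
  constructor
  · apply sum_digits_injective
    rw [← pairCode_mod x y, ← pairCode_mod x' y', h]
  · apply sum_digits_injective
    rw [← pairCode_div x y, ← pairCode_div x' y', h]

theorem exists_pairCode_eq {c : ℕ} (hc : c < m ^ k * n ^ k) :
    ∃ (x : Fin k → Fin m) (y : Fin k → Fin n), pairCode x y = c := by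
  have hpos : 0 < m ^ k := Nat.pos_of_ne_zero fun h => by simp [h] at hc
  obtain ⟨x, hx⟩ := exists_sum_digits (Nat.mod_lt c hpos)
  obtain ⟨y, hy⟩ := exists_sum_digits (Nat.div_lt_of_lt_mul hc)
  exact ⟨x, y, by rw [pairCode, hx, hy, Nat.mod_add_div]⟩

theorem relTable_ne_zero_iff {P : (Fin k → Fin m) → Prop} :
    relTable P (∑ i : Fin k, (x i : ℕ) * m ^ (i : ℕ)) ≠ 0 ↔ P x := by
  simp only [relTable, ne_eq, ite_eq_right_iff, one_ne_zero, imp_false, not_not]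
  exact ⟨fun ⟨x', h, hx'⟩ => sum_digits_injective h ▸ hx', fun h => ⟨x, rfl, h⟩⟩

end

/-! ### The refinement step in terms of codes -/

section

/-- The degree condition for a relation between numbers below `m` and numbers below `n`. -/
def NatDegreeCond (m n : ℕ) (E : ℕ → ℕ → Prop) : Prop :=
  open Classical in
  (∀ a < m, ∃ b < n, E a b) ∧ (∀ b < n, ∃ a < m, E a b) ∧
    ∀ a < m, ∀ b < n, E a b → ((Finset.range n).filter fun b' => E a b').card =
      ((Finset.range m).filter fun a' => E a' b).card

open Classical in
theorem card_filter_range_eq (n : ℕ) (P : ℕ → Prop) :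
    ((Finset.range n).filter P).card = Nat.card {b : Fin n // P b} := by
  rw [Finset.card_filter, Finset.sum_range, ← Finset.card_filter, Nat.card_eq_fintype_card,
    Fintype.card_subtype]

theorem natDegreeCond_iff {m n : ℕ} {E : ℕ → ℕ → Prop} :
    NatDegreeCond m n E ↔ DegreeCond fun (a : Fin m) (b : Fin n) => E a b := by
  simp only [NatDegreeCond, DegreeCond, card_filter_range_eq, Fin.forall_iff, Fin.exists_iff,
    exists_prop]

variable {L : FirstOrder.Language.{u, v}} {r : ℕ}

/-- The pair of tuples with code `c` is a partial isomorphism, according to the tables of the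
relations in the arrays `0, …, r - 1` and `r, …, 2 r - 1`. -/
def InitCond (e : Fin r ≃ Σ n, L.Relations n) (k : ℕ) (arr : ℕ → ℕ → ℕ) (m n c : ℕ) : Prop :=
  (∀ i j : Fin k, leftDigit k m i c = leftDigit k m j c ↔
    rightDigit k m n i c = rightDigit k m n j c) ∧
  ∀ (s : Fin r) (g : Fin (e s).1 → Fin k),
    arr s (∑ i, leftDigit k m (g i) c * m ^ (i : ℕ)) ≠ 0 ↔
      arr (r + s) (∑ i, rightDigit k m n (g i) c * n ^ (i : ℕ)) ≠ 0

/-- The relations without arguments agree, according to their tables. -/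
def NullaryCond (e : Fin r ≃ Σ n, L.Relations n) (arr : ℕ → ℕ → ℕ) : Prop :=
  ∀ s : Fin r, (e s).1 = 0 → (arr s 0 ≠ 0 ↔ arr (r + s) 0 ≠ 0)

section

variable (e : Fin r ≃ Σ n, L.Relations n) {m n : ℕ} [L.Structure (Fin m)] [L.Structure (Fin n)]
  {arr : ℕ → ℕ → ℕ} (harr : ∀ a < 2 * r, arr a = (inputState e m n).arr a)

include harr

theorem inputState_left (s : Fin r) (x : Fin (e s).1 → Fin m) :
    arr s (∑ i, (x i : ℕ) * m ^ (i : ℕ)) ≠ 0 ↔ RelMap (e s).2 x := by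
  rw [harr s (by omega)]
  simp only [inputState, s.2, dif_pos]
  exact relTable_ne_zero_iff x

theorem inputState_right (s : Fin r) (x : Fin (e s).1 → Fin n) :
    arr (r + s) (∑ i, (x i : ℕ) * n ^ (i : ℕ)) ≠ 0 ↔ RelMap (e s).2 x := by
  rw [harr (r + s) (by omega)]
  have h1 : ¬ r + (s : ℕ) < r := by omega
  have h2 : r + (s : ℕ) - r < r := by omega
  simp only [inputState, h1, dif_neg, not_false_iff, h2, dif_pos]
  have key : ∀ (q : ℕ) (hq : q < r), q = s →
      (relTable (fun z : Fin (e ⟨q, hq⟩).1 → Fin n => RelMap (e ⟨q, hq⟩).2 z)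
        (∑ i, (x i : ℕ) * n ^ (i : ℕ)) ≠ 0 ↔ RelMap (e s).2 x) := by
    rintro _ _ rfl
    exact relTable_ne_zero_iff x
  exact key _ h2 (by omega)

theorem initCond_iff {k : ℕ} (x : Fin k → Fin m) (y : Fin k → Fin n) :
    InitCond e k arr m n (pairCode x y) ↔ atp L x = atp L y := by
  simp only [InitCond, leftDigit_pairCode, rightDigit_pairCode]
  simp only [inputState_left e harr _ fun i => x _, inputState_right e harr _ fun i => y _,
    atp, AtomicType.mk.injEq, Fin.val_inj]
  refine and_congr ?_ ?_
  · simp only [funext_iff, eq_iff_iff]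
  · simp only [funext_iff, eq_iff_iff]
    constructor
    · intro h n R
      obtain ⟨s, hs⟩ := e.surjective ⟨n, R⟩
      have := h s
      rw [hs] at this
      exact this
    · exact fun h s g => h _ (e s).2 g

theorem nullaryCond_iff :
    NullaryCond e arr ↔ ∀ R : L.Relations 0,
      (RelMap R (Fin.elim0 : Fin 0 → Fin m) ↔ RelMap R (Fin.elim0 : Fin 0 → Fin n)) := by
  have key : ∀ s : Fin r, (e s).1 = 0 → ∀ (x : Fin (e s).1 → Fin m) (y : Fin (e s).1 → Fin n),
      (arr s 0 ≠ 0 ↔ arr (r + s) 0 ≠ 0) ↔ (RelMap (e s).2 x ↔ RelMap (e s).2 y) := by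
    intro s hs x y
    have h1 := inputState_left e harr s x
    have h2 := inputState_right e harr s y
    have : IsEmpty (Fin (e s).1) := by rw [hs]; infer_instance
    rw [Finset.univ_eq_empty, Finset.sum_empty] at h1 h2
    rw [h1, h2]
  constructor
  · intro h R
    obtain ⟨s, hs⟩ := e.surjective ⟨0, R⟩
    have h' := h s
    have := key s
    rw [hs] at this h'
    exact (this rfl _ _).1 (h' rfl)
  · intro h s hs
    have := key s hs
    generalize e s = q at *
    obtain ⟨l, R⟩ := q
    obtain rfl : l = 0 := hs
    exact (this _ _).2 (h R)

end

/-! ### The conditions are decidable in polynomial time -/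

variable {α : Type*} {C : Ctx α} {m n c : α → ℕ}

theorem Comp.leftDigit (k j : ℕ) (hm : Comp C m) (hc : Comp C c) :
    Comp C fun x => leftDigit k (m x) j (c x) :=
  ((hc.mod (hm.pow k)).div (hm.pow j)).mod hm

theorem Comp.rightDigit (k j : ℕ) (hm : Comp C m) (hn : Comp C n) (hc : Comp C c) :
    Comp C fun x => rightDigit k (m x) (n x) j (c x) :=
  ((hc.div (hm.pow k)).div (hn.pow j)).mod hn

theorem Comp.recode (k j : ℕ) {a b : α → ℕ} (hm : Comp C m) (hn : Comp C n) (hc : Comp C c)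
    (ha : Comp C a) (hb : Comp C b) :
    Comp C fun x => recode k (m x) (n x) j (c x) (a x) (b x) :=
  (((hc.mod (hm.pow k)).sub ((hm.leftDigit k j hc).mul (hm.pow j))).add (ha.mul (hm.pow j))).add
    ((hm.pow k).mul (((hc.div (hm.pow k)).sub ((hm.rightDigit k j hn hc).mul (hn.pow j))).add
      (hb.mul (hn.pow j))))

theorem DecPoly.initCond (e : Fin r ≃ Σ n, L.Relations n) (k : ℕ) (hm : Comp C m)
    (hn : Comp C n) (hc : Comp C c) :
    DecPoly C fun x => InitCond e k (C.arr x) (m x) (n x) (c x) :=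
  (DecPoly.forall (ι := Fin k) fun i => DecPoly.forall (ι := Fin k) fun j =>
      (DecPoly.eq (hm.leftDigit k i hc) (hm.leftDigit k j hc)).iff
        (DecPoly.eq (hm.rightDigit k i hn hc) (hm.rightDigit k j hn hc))).and
    (DecPoly.forall (ι := Fin r) fun s => DecPoly.forall (ι := Fin (e s).1 → Fin k) fun g =>
      (DecPoly.get (Comp.finset_sum _ fun i => (hm.leftDigit k (g i) hc).mul (hm.pow i)) s).iff
        (DecPoly.get (Comp.finset_sum _ fun i =>
          (hm.rightDigit k (g i) hn hc).mul (hn.pow i)) (r + s)))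

theorem DecPoly.nullaryCond (e : Fin r ≃ Σ n, L.Relations n) :
    DecPoly C fun x => NullaryCond e (C.arr x) :=
  DecPoly.forall (ι := Fin r) fun s => (DecPoly.const _).imp
    ((DecPoly.get (.lit 0) s).iff (DecPoly.get (.lit 0) (r + s)))

theorem DecPoly.natDegreeCond (k j w : ℕ) {o : α → ℕ} (hm : Comp C m) (hn : Comp C n)
    (hc : Comp C c) (ho : Comp C o) :
    DecPoly C fun x => NatDegreeCond (m x) (n x) fun a b =>
      C.arr x w (o x + CountingPresheaf.recode k (m x) (n x) j (c x) a b) ≠ 0 := by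
  have h1 : DecPoly C.ext.ext fun p => C.arr p.1.1 w (o p.1.1 +
      CountingPresheaf.recode k (m p.1.1) (n p.1.1) j (c p.1.1) p.1.2 p.2) ≠ 0 :=
    DecPoly.get (C := C.ext.ext) (ho.ext.ext.add
      (Comp.recode k j hm.ext.ext hn.ext.ext hc.ext.ext Comp.snd.ext Comp.snd)) w
  have h2 : DecPoly C.ext.ext fun p => C.arr p.1.1 w (o p.1.1 +
      CountingPresheaf.recode k (m p.1.1) (n p.1.1) j (c p.1.1) p.2 p.1.2) ≠ 0 :=
    DecPoly.get (C := C.ext.ext) (ho.ext.ext.add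
      (Comp.recode k j hm.ext.ext hn.ext.ext hc.ext.ext Comp.snd Comp.snd.ext)) w
  have h3 : DecPoly C.ext.ext.ext fun p => C.arr p.1.1.1 w (o p.1.1.1 +
      CountingPresheaf.recode k (m p.1.1.1) (n p.1.1.1) j (c p.1.1.1) p.1.1.2 p.2) ≠ 0 :=
    DecPoly.get (C := C.ext.ext.ext) (ho.ext.ext.ext.add
      (Comp.recode k j hm.ext.ext.ext hn.ext.ext.ext hc.ext.ext.ext Comp.snd.ext.ext
        Comp.snd)) w
  have h4 : DecPoly C.ext.ext.ext fun p => C.arr p.1.1.1 w (o p.1.1.1 +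
      CountingPresheaf.recode k (m p.1.1.1) (n p.1.1.1) j (c p.1.1.1) p.2 p.1.2) ≠ 0 :=
    DecPoly.get (C := C.ext.ext.ext) (ho.ext.ext.ext.add
      (Comp.recode k j hm.ext.ext.ext hn.ext.ext.ext hc.ext.ext.ext Comp.snd
        Comp.snd.ext)) w
  exact (DecPoly.ball hm (DecPoly.bexists hn.ext h1)).and
    ((DecPoly.ball hn (DecPoly.bexists hm.ext h2)).and
      (DecPoly.ball hm (DecPoly.ball hn.ext (h1.imp
        (DecPoly.eq (DecPoly.count hn.ext.ext h3) (DecPoly.count hm.ext.ext h4))))))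

end

/-! ### The program -/

section

variable {L : FirstOrder.Language.{u, v}} {r : ℕ}

/-- The table of all rounds of the refinement: position `i * M + c`, with `M` the number of codes,
tells whether the pair with code `c` survives `i` rounds. -/
def RoundTable (L : FirstOrder.Language.{u, v}) (k m n : ℕ) [L.Structure (Fin m)]
    [L.Structure (Fin n)] (p : ℕ) : Prop :=
  ∃ (x : Fin k → Fin m) (y : Fin k → Fin n),
    pairCode x y = p % (m ^ k * n ^ k) ∧ tupleIter L (p / (m ^ k * n ^ k)) x y

/-- The entry of the table of rounds at position `p` according to the previous entries, which are
read from the array `w`. -/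
def RoundStep (e : Fin r ≃ Σ n, L.Relations n) (k w m n : ℕ) (arr : ℕ → ℕ → ℕ) (p : ℕ) : Prop :=
  (p < m ^ k * n ^ k ∧ InitCond e k arr m n p) ∨
    (m ^ k * n ^ k ≤ p ∧ arr w (p - m ^ k * n ^ k) ≠ 0 ∧ ∀ j : Fin k, NatDegreeCond m n fun a b =>
      arr w ((p / (m ^ k * n ^ k) - 1) * (m ^ k * n ^ k) +
        recode k m n j (p % (m ^ k * n ^ k)) a b) ≠ 0)

theorem decPoly_roundStep (e : Fin r ≃ Σ n, L.Relations n) (k w : ℕ) :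
    DecPoly baseCtx.ext fun q => RoundStep e k w q.1.1 q.1.2.1 q.1.2.2 q.2 := by
  have hm : Comp baseCtx.ext fun q => q.1.1 := Comp.base_fst.ext
  have hn : Comp baseCtx.ext fun q => q.1.2.1 := Comp.base_snd.ext
  have hp : Comp baseCtx.ext fun q => q.2 := Comp.snd
  have hM := (hm.pow k).mul (hn.pow k)
  exact ((DecPoly.lt hp hM).and (DecPoly.initCond e k hm hn hp)).or
    ((DecPoly.le hM hp).and ((DecPoly.get (hp.sub hM) w).and
      (DecPoly.forall (ι := Fin k) fun j => DecPoly.natDegreeCond k j w hm hn (hp.mod hM)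
        (((hp.div hM).sub (.lit 1)).mul hM))))

variable {k m n : ℕ} [L.Structure (Fin m)] [L.Structure (Fin n)]

theorem mul_add_div_of_lt {a b c : ℕ} (h : c < b) : (a * b + c) / b = a := by
  rw [mul_comm, Nat.mul_add_div (by omega), Nat.div_eq_of_lt h, add_zero]

theorem roundTable_iff (i : ℕ) (x : Fin k → Fin m) (y : Fin k → Fin n) :
    RoundTable L k m n (i * (m ^ k * n ^ k) + pairCode x y) ↔ tupleIter L i x y := by
  have hlt := pairCode_lt x y
  rw [RoundTable, Nat.mul_add_mod_of_lt hlt, mul_add_div_of_lt hlt]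
  constructor
  · rintro ⟨x', y', h, h'⟩
    obtain ⟨rfl, rfl⟩ := pairCode_injective h
    exact h'
  · exact fun h => ⟨x, y, rfl, h⟩

theorem roundStep_iff (e : Fin r ≃ Σ n, L.Relations n) {w p : ℕ} (hw : 2 * r ≤ w)
    (hM : 0 < m ^ k * n ^ k) {arr : ℕ → ℕ → ℕ}
    (harr : ∀ a ≠ w, arr a = (inputState e m n).arr a)
    (hprev : ∀ p' < p, arr w p' ≠ 0 ↔ RoundTable L k m n p') :
    RoundStep e k w m n arr p ↔ RoundTable L k m n p := by
  obtain ⟨x, y, hxy⟩ := exists_pairCode_eq (Nat.mod_lt p hM)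
  have hlt := pairCode_lt x y
  obtain ⟨i, rfl⟩ : ∃ i, p = i * (m ^ k * n ^ k) + pairCode x y :=
    ⟨p / (m ^ k * n ^ k), by rw [hxy, mul_comm, Nat.div_add_mod]⟩
  rw [roundTable_iff, RoundStep, Nat.mul_add_mod_of_lt hlt, mul_add_div_of_lt hlt]
  cases i with
  | zero =>
    have h2 : ¬ m ^ k * n ^ k ≤ pairCode x y := not_le.2 hlt
    simp only [zero_mul, zero_add, hlt, h2, true_and, false_and, or_false]
    exact initCond_iff e (fun a ha => harr a (by omega)) x y
  | succ i =>
    rw [Nat.succ_mul] at hprev ⊢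
    have h1 : ¬ i * (m ^ k * n ^ k) + m ^ k * n ^ k + pairCode x y < m ^ k * n ^ k := by omega
    have h2 : m ^ k * n ^ k ≤ i * (m ^ k * n ^ k) + m ^ k * n ^ k + pairCode x y := by omega
    have h3 : i * (m ^ k * n ^ k) + m ^ k * n ^ k + pairCode x y - m ^ k * n ^ k =
      i * (m ^ k * n ^ k) + pairCode x y := by omega
    simp only [h1, h2, h3, false_and, true_and, false_or, Nat.add_sub_cancel, natDegreeCond_iff,
      recode_pairCode]
    have key : ∀ (x : Fin k → Fin m) (y : Fin k → Fin n),
        arr w (i * (m ^ k * n ^ k) + pairCode x y) ≠ 0 ↔ tupleIter L i x y := fun x y =>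
      (hprev _ (by have := pairCode_lt x y; omega)).trans (roundTable_iff i x y)
    simp only [key]
    exact tupleIter_succ_iff.symm

variable (L k) in
/-- A program computes the fixpoint in polynomial time. -/
theorem exists_program (e : Fin r ≃ Σ n, L.Relations n) :
    ∃ (prog : RamProg) (p : Polynomial ℕ),
      ∀ (m n : ℕ) [L.Structure (Fin m)] [L.Structure (Fin n)],
        Runs prog (inputState e m n) (p.eval (m + n)) fun τ =>
          Represents τ (cofp L (Fin m) (Fin n) k) := by
  classical
  have hM : Comp baseCtx fun x => x.1 ^ k * x.2.1 ^ k :=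
    (Comp.base_fst.pow k).mul (Comp.base_snd.pow k)
  -- The array `2 r + 1` receives the table of rounds, the array `2 r + 2` the answer whether there
  -- is any section, and the array `0` the last round.
  obtain ⟨prog₁, q₁, h₁⟩ := exists_fill (2 * r + 1)
    (f := fun m n => m ^ k * n ^ k * (m ^ k * n ^ k + 1)) (hM.mul (hM.add (.lit 1)))
    (decPoly_roundStep e k (2 * r + 1))
  obtain ⟨prog₂, q₂, h₂⟩ := exists_fill (2 * r + 2) (f := fun _ _ => 1) (.lit 1)
    (P := fun q => (∃ c < q.1.1 ^ k * q.1.2.1 ^ k, q.1.2.2 (2 * r + 1)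
      ((q.1.1 ^ k * q.1.2.1 ^ k) * (q.1.1 ^ k * q.1.2.1 ^ k) + c) ≠ 0) ∨
      (k ≠ 0 ∧ q.1.1 = 0 ∧ q.1.2.1 = 0 ∧ NullaryCond e q.1.2.2))
    ((DecPoly.bexists hM.ext (DecPoly.get (C := baseCtx.ext.ext)
        ((hM.ext.ext.mul hM.ext.ext).add .snd) (2 * r + 1))).or
      ((DecPoly.const _).and ((DecPoly.eq Comp.base_fst.ext (.lit 0)).and
        ((DecPoly.eq Comp.base_snd.ext (.lit 0)).and (DecPoly.nullaryCond e)))))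
  obtain ⟨prog₃, q₃, h₃⟩ := exists_fill 0 (f := fun m n => m ^ k * n ^ k) hM
    (P := fun q => q.1.2.2 (2 * r + 1)
      ((q.1.1 ^ k * q.1.2.1 ^ k) * (q.1.1 ^ k * q.1.2.1 ^ k) + q.2) ≠ 0)
    (DecPoly.get (C := baseCtx.ext) ((hM.ext.mul hM.ext).add .snd) (2 * r + 1))
  refine ⟨.seq prog₁ (.seq prog₂ (.seq prog₃ (.assign 0 (.get (2 * r + 2) (.lit 0))))),
    q₁ + q₂ + q₃ + 6, fun m n _ _ => ?_⟩
  set M := m ^ k * n ^ k with hMdef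
  have hlast : ∀ (x : Fin k → Fin m) (y : Fin k → Fin n), RoundTable L k m n (M * M + pairCode x y)
      ↔ Covered (cofp L (Fin m) (Fin n) k) (zipPairs x y) := fun x y =>
    (roundTable_iff M x y).trans (tupleIter_iff_covered (by simp [hMdef]))
  have hpres := (isStrategy_cofp (A := Fin m) (B := Fin n) (k := k) L).isPresheaf
  -- The table of rounds as it is found in a state.
  have htable : ∀ arr : ℕ → ℕ → ℕ,
      (∀ c < M * (M + 1), arr (2 * r + 1) c = if RoundTable L k m n c then 1 else 0) →
      ∀ c < M, arr (2 * r + 1) (M * M + c) ≠ 0 ↔ RoundTable L k m n (M * M + c) := by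
    intro arr harr c hc
    rw [harr _ (by rw [Nat.mul_succ]; omega)]
    split_ifs with h <;> simp [h]
  have run₁ := h₁ m n (inputState e m n) (RoundTable L k m n) rfl rfl fun c hc arr harr hprev =>
    roundStep_iff e (by omega) (Nat.pos_of_ne_zero fun h => by simp [h] at hc) harr fun p' hp' => by
      change arr (2 * r + 1) p' ≠ 0 ↔ RoundTable L k m n p'
      rw [hprev p' hp']
      split_ifs with h <;> simp [h]
  refine Runs.mono (run₁.seq fun σ₁ hσ₁ => Runs.seq (h₂ m n σ₁
    (fun _ => cofp L (Fin m) (Fin n) k ≠ ⊥) hσ₁.1 hσ₁.2.1 fun c _ arr harr _ => ?_)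
    fun σ₂ hσ₂ => Runs.seq (h₃ m n σ₂ (fun c => RoundTable L k m n (M * M + c)) hσ₂.1 hσ₂.2.1
      fun c hc arr harr _ => ?_) fun σ₃ hσ₃ => Runs.assign
        (R := fun τ => Represents τ (cofp L (Fin m) (Fin n) k)) ?_) ?_ fun _ => id
  · have harr₁ : ∀ c < M * (M + 1),
        arr (2 * r + 1) c = if RoundTable L k m n c then 1 else 0 := by
      rw [harr _ (by omega)]; exact hσ₁.2.2.2
    rw [cofp_ne_bot_iff_tuples, ← nullaryCond_iff e (arr := arr) fun a ha => by
      rw [harr a (by omega), hσ₁.2.2.1 a (by omega)]]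
    simp only [Fintype.card_fin]
    refine or_congr_left ⟨?_, ?_⟩
    · rintro ⟨c, hc, h⟩
      obtain ⟨x, y, rfl⟩ := exists_pairCode_eq hc
      exact ⟨x, y, (hlast x y).1 ((htable arr harr₁ _ hc).1 h)⟩
    · rintro ⟨x, y, h⟩
      exact ⟨_, pairCode_lt x y, (htable arr harr₁ _ (pairCode_lt x y)).2 ((hlast x y).2 h)⟩
  · refine htable arr ?_ c hc
    rw [harr _ (by omega), hσ₂.2.2.1 _ (by omega)]
    exact hσ₁.2.2.2
  · have hval : (RamExpr.get (2 * r + 2) (.lit 0)).eval σ₃ =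
        σ₂.arr (2 * r + 2) 0 := by
      rw [RamExpr.eval, hσ₃.2.2.1 _ (by omega)]; rfl
    have hans := hσ₂.2.2.2 0 Nat.one_pos
    refine ⟨fun h => ?_, fun h => ?_, fun x y => ?_⟩
    · rw [RamState.var_set_self, hval, hans, if_pos h]
    · rw [RamState.var_set_self, hval, hans, if_neg (not_not.2 h)]
    · have := hσ₃.2.2.2 (pairCode x y) (pairCode_lt x y)
      rw [hasGraph_iff_covered hpres, ← hlast]
      exact ⟨fun h => this.trans (if_pos h), fun h => this.trans (if_neg h)⟩
  · simp only [RamExpr.cost, Polynomial.eval_add]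
    have : (6 : Polynomial ℕ).eval (m + n) = 6 := by simp
    omega

end

end CountingPresheaf

open CountingPresheaf in
theorem mainTheorem10 {L : FirstOrder.Language.{u, v}} [L.IsRelational] {r : ℕ}
    (e : Fin r ≃ Σ n, L.Relations n) (k : ℕ) :
    -- the process is decreasing, and reaches its limit, a fixpoint, in polynomially many iterations
    (∀ (A : Type w) (B : Type w') [Fintype A] [DecidableEq A] [Fintype B]
        [L.Structure A] [L.Structure B],
      (∀ i, cofpIter L A B k (i + 1) ≤ cofpIter L A B k i) ∧
      coflasq (cotestFilter (cofp L A B k)) = cofp L A B k ∧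
      ∃ N ≤ (Fintype.card A * Fintype.card B + 1) ^ k,
        ∀ i ≥ N, cofpIter L A B k i = cofp L A B k) ∧
    -- the fixpoint is nonempty iff the structures are equivalent in counting logic
    (∀ (A : Type w) (B : Type w') [Fintype A] [DecidableEq A] [Fintype B]
        [L.Structure A] [L.Structure B],
      cofp L A B k ≠ ⊥ ↔ CountingEquiv L A B k) ∧
    -- equivalently, they agree at level `k - 1` of the Weisfeiler-Leman algorithm
    (1 ≤ k → ∀ (A : Type w) (B : Type w') [Fintype A] [DecidableEq A] [Nonempty A] [Fintype B]
        [L.Structure A] [L.Structure B],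
      cofp L A B k ≠ ⊥ ↔ WLEquiv L A B (k - 1)) ∧
    -- a program computes the fixpoint in polynomial time, and so decides these equivalences
    (∃ (prog : RamProg) (p : Polynomial ℕ),
      ∀ (m n : ℕ) [L.Structure (Fin m)] [L.Structure (Fin n)],
        ∃ (t : ℕ) (τ : RamState),
          Exec prog (inputState e m n) t τ ∧ t ≤ p.eval (m + n) ∧
          Represents τ (cofp L (Fin m) (Fin n) k) ∧
          (τ.var 0 = 1 ↔ CountingEquiv L (Fin m) (Fin n) k) ∧
          (1 ≤ k → 1 ≤ m → (τ.var 0 = 1 ↔ WLEquiv L (Fin m) (Fin n) (k - 1)))) := by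
  refine ⟨fun A B _ _ _ _ _ => ⟨cofpIter_succ_le L, coflasq_cotestFilter_cofp L,
    exists_cofpIter_eq_cofp L⟩, fun A B _ _ _ _ _ => cofp_ne_bot_iff_countingEquiv, ?_, ?_⟩
  · intro hk A B _ _ _ _ _ _
    obtain ⟨d, rfl⟩ := Nat.exists_eq_add_of_le' hk
    exact cofp_ne_bot_iff_wlEquiv
  · obtain ⟨prog, p, h⟩ := exists_program L k e
    refine ⟨prog, p, fun m n _ _ => ?_⟩
    obtain ⟨t, τ, hexec, ht, hτ⟩ := h m n
    have hvar : τ.var 0 = 1 ↔ cofp L (Fin m) (Fin n) k ≠ ⊥ :=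
      ⟨fun h1 h0 => by simp [hτ.2.1 h0] at h1, hτ.1⟩
    refine ⟨t, τ, hexec, ht, hτ, hvar.trans cofp_ne_bot_iff_countingEquiv, fun hk hm => ?_⟩
    obtain ⟨d, rfl⟩ := Nat.exists_eq_add_of_le' hk
    have : Nonempty (Fin m) := ⟨⟨0, hm⟩⟩
    exact hvar.trans cofp_ne_bot_iff_wlEquiv
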